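/- Theorem 3 (Canonical forms for $G(p,q)$). Let $p,q\ge 3$ be integers with $p$ even and $q$ not divisible by $4$. Let $A=R_x^{2\pi/p}$ and $B=R_z^{2\pi/q}$ be the rotations of $\mathbb R^3$ about the $x$-axis by the angle $2\pi/p$ and about the $z$-axis by the angle $2\pi/q$, and let $G(p,q)\subset SO(3)$ be the group generated by $A$ and $B$. Consider formal products $$A^{a_1}B^{b_1}A^{a_2}B^{b_2}\cdots A^{a_n}B^{b_n},\qquad n\ge 1,\ a_i,b_i\in\mathbb Z, \tag{$*$}$$ in which all exponents are nonzero except perhaps $a_1$ and $b_n$. Let $J=(-\frac q2,\frac q2)$ if $q$ is odd and $J=(-\frac q4,\frac q4)$ if $q$ is even. Such a product is in - *L-canonical form* if $a_1\in(-\frac p2,\frac p2]$; $a_i\in(-\frac p4,\frac p4]$ for $i>1$; $b_1\in(-\frac q2,\frac q2]$, with $b_1=\frac q2$ only if $n=1$; and $b_j\in J$ for $j>1$; - *R-canonical form* if $a_i\in(-\frac p4,\frac p4]$ for $i<n$; $a_n\in(-\frac p2,\frac p2]$, with $a_n=\frac p2$ only if $n=1$; $b_n\in(-\frac q2,\frac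 q2]$; and $b_j\in J$ for $j<n$; - *C-canonical form* if $a_1\in(-\frac p2,\frac p2]$; $a_i\in(-\frac p4,\frac p4]$ for $i>1$; $b_n\in(-\frac q2,\frac q2]$; and $b_j\in J$ for $j<n$. Then every element of $G(p,q)$ is the value of exactly one product $(*)$ in L-canonical form, of exactly one product $(*)$ in R-canonical form, and of exactly one product $(*)$ in C-canonical form. -/

import Mathlib

namespace RadinSadun

/-- The special orthogonal group `SO(3)` of real `3 × 3` matrices. -/
abbrev SO3 : Type := Matrix.specialOrthogonalGroup (Fin 3) ℝ

/-- The rotation `R_x^θ` by the angle `θ` about the `x`-axis. -/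
noncomputable def rotX (θ : ℝ) : SO3 :=
  ⟨!![1, 0, 0;
      0, Real.cos θ, -Real.sin θ;
      0, Real.sin θ, Real.cos θ], by
    have h := Real.cos_sq_add_sin_sq θ
    rw [Matrix.mem_specialOrthogonalGroup_iff, Matrix.mem_orthogonalGroup_iff]
    constructor
    · ext i j
      fin_cases i <;> fin_cases j <;>
        simp [Matrix.mul_apply, Fin.sum_univ_three] <;> linarith
    · simp [Matrix.det_fin_three]
      linarith⟩

/-- The rotation `R_z^θ` by the angle `θ` about the `z`-axis. -/
noncomputable def rotZ (θ : ℝ) : SO3 :=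
  ⟨!![Real.cos θ, -Real.sin θ, 0;
      Real.sin θ, Real.cos θ, 0;
      0, 0, 1], by
    have h := Real.cos_sq_add_sin_sq θ
    rw [Matrix.mem_specialOrthogonalGroup_iff, Matrix.mem_orthogonalGroup_iff]
    constructor
    · ext i j
      fin_cases i <;> fin_cases j <;>
        simp [Matrix.mul_apply, Fin.sum_univ_three] <;> linarith
    · simp [Matrix.det_fin_three]
      linarith⟩

/-- The generator `A = R_x^{2π/p}`. -/
noncomputable def genA (p : ℕ) : SO3 := rotX (2 * Real.pi / p)

/-- The generator `B = R_z^{2π/q}`. -/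
noncomputable def genB (q : ℕ) : SO3 := rotZ (2 * Real.pi / q)

/-- `G(p,q)`, the subgroup of `SO(3)` generated by `A` and `B`. -/
noncomputable def G (p q : ℕ) : Subgroup SO3 := Subgroup.closure {genA p, genB q}

/-- A formal product `A^{a_1} B^{b_1} ⋯ A^{a_n} B^{b_n}` is recorded as the list
`[(a_1, b_1), …, (a_n, b_n)]` of its exponents; `w[i]` holds `(a_{i+1}, b_{i+1})`.
This is its value in `SO(3)`. -/
noncomputable def wordProd (p q : ℕ) (w : List (ℤ × ℤ)) : SO3 :=
  (w.map fun x => genA p ^ x.1 * genB q ^ x.2).prod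

/-- The product has at least one factor `A^a B^b`, and all its exponents are nonzero, except
perhaps the first exponent `a_1` and the last exponent `b_n`. -/
def IsReduced (w : List (ℤ × ℤ)) : Prop :=
  0 < w.length ∧ ∀ (i : ℕ) (hi : i < w.length),
    (0 < i → w[i].1 ≠ 0) ∧ (i + 1 < w.length → w[i].2 ≠ 0)

/-- `a ∈ (-m/2, m/2]`. -/
def InHalf (m : ℕ) (a : ℤ) : Prop := (a : ℚ) ∈ Set.Ioc (-((m : ℚ) / 2)) ((m : ℚ) / 2)

/-- `a ∈ (-m/4, m/4]`. -/
def InQuarter (m : ℕ) (a : ℤ) : Prop := (a : ℚ) ∈ Set.Ioc (-((m : ℚ) / 4)) ((m : ℚ) / 4)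

/-- `b ∈ (-q/2, q/2)` if `q` is odd and `b ∈ (-q/4, q/4)` if `q` is even. -/
def InSmall (q : ℕ) (b : ℤ) : Prop :=
  (Odd q → (b : ℚ) ∈ Set.Ioo (-((q : ℚ) / 2)) ((q : ℚ) / 2)) ∧
  (Even q → (b : ℚ) ∈ Set.Ioo (-((q : ℚ) / 4)) ((q : ℚ) / 4))

/-- L-canonical form: `a_1 ∈ (-p/2, p/2]`, `a_i ∈ (-p/4, p/4]` for `i > 1`;
`b_1 ∈ (-q/2, q/2]`, equal to `q/2` only if `n = 1`, and `b_j` is in the small interval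
for `j > 1`. -/
def IsLCanonical (p q : ℕ) (w : List (ℤ × ℤ)) : Prop :=
  IsReduced w ∧ ∀ (i : ℕ) (hi : i < w.length),
    (0 < i → InQuarter p w[i].1) ∧
    (i = 0 → InHalf p w[i].1) ∧
    (i = 0 → InHalf q w[i].2 ∧ ((w[i].2 : ℚ) = (q : ℚ) / 2 → w.length = 1)) ∧
    (0 < i → InSmall q w[i].2)

/-- R-canonical form: `a_i ∈ (-p/4, p/4]` for `i < n`, `a_n ∈ (-p/2, p/2]`, equal to `p/2`
only if `n = 1`; `b_n ∈ (-q/2, q/2]`, and `b_j` is in the small interval for `j < n`. -/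
def IsRCanonical (p q : ℕ) (w : List (ℤ × ℤ)) : Prop :=
  IsReduced w ∧ ∀ (i : ℕ) (hi : i < w.length),
    (i + 1 < w.length → InQuarter p w[i].1) ∧
    (i + 1 = w.length → InHalf p w[i].1 ∧ ((w[i].1 : ℚ) = (p : ℚ) / 2 → w.length = 1)) ∧
    (i + 1 = w.length → InHalf q w[i].2) ∧
    (i + 1 < w.length → InSmall q w[i].2)

/-- C-canonical form: `a_1 ∈ (-p/2, p/2]`, `a_i ∈ (-p/4, p/4]` for `i > 1`;
`b_n ∈ (-q/2, q/2]`, and `b_j` is in the small interval for `j < n`. -/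
def IsCCanonical (p q : ℕ) (w : List (ℤ × ℤ)) : Prop :=
  IsReduced w ∧ ∀ (i : ℕ) (hi : i < w.length),
    (0 < i → InQuarter p w[i].1) ∧
    (i = 0 → InHalf p w[i].1) ∧
    (i + 1 = w.length → InHalf q w[i].2) ∧
    (i + 1 < w.length → InSmall q w[i].2)

end RadinSadun

/-! Write p = 2P, and q = Q or 2Q with Q odd. The half-turn A^P inverts B, and B^Q is trivial or a
half-turn inverting A. So A^P and B^Q generate a small abelian group, the `core`, which moves past
any syllable A^a B^b at the cost of signs. Pushing it to one end writes each element of G(p,q) as a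
normal word, with A-exponents reduced mod P and B-exponents mod Q, times a core element
(`PingPong.exists_normal`). This is the normal form of an amalgamated product over the core.

Uniqueness (`PingPong.normal_unique`) is ping-pong with a 2-adic valuation v extended to ℂ. The
cosine of a rational angle that is not a multiple of π/2 satisfies v > 1 (`one_lt_valuation_cos`),
and then the sine has the same valuation. Following the valuations of the first column of a matrix
shows that noncore powers of B and of A carry two disjoint sets into each other
(`rotZ_mul_mem_equalSet`, `rotX_mul_mem_unequalSet`).

The L, R and C forms arise by putting the core element on the left, on the right, or A^P-powers left
and B^Q-powers right, and absorbing it into the end syllables (`PingPong.existsUnique_isForm`). -/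

namespace RadinSadun

/-! ### 2-adic size of roots of unity and cosines. -/

/-- There is a `2`-adic valuation on `ℂ`. -/
theorem exists_valuation_two_lt_one :
    ∃ (Γ₀ : Type) (_ : LinearOrderedCommGroupWithZero Γ₀) (v : Valuation ℂ Γ₀), v 2 < 1 := by
  let f : ℤ →+* ℂ := Int.castRingHom ℂ
  have hinj : Function.Injective f := Int.cast_injective
  have hI : Ideal.span {(2 : f.range)} ≠ ⊤ := by
    rw [Ne, Ideal.span_singleton_eq_top]
    intro h
    obtain ⟨⟨_, n, rfl⟩, hy⟩ := h.exists_right_inv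
    have h1 : (2 : ℂ) * f n = 1 := congrArg Subtype.val hy
    have h2 : (2 * n : ℤ) = 1 := hinj (by simpa using h1)
    omega
  -- A proper ideal of a subring of a field lies in the nonunits of some valuation ring of that
  -- field.
  obtain ⟨V, -, hV⟩ := Ideal.image_subset_nonunits_valuationSubring _ hI
  refine ⟨V.ValueGroup, inferInstance, V.valuation, ?_⟩
  have : (2 : ℂ) ∈ V.nonunits := hV ⟨2, Ideal.subset_span rfl, rfl⟩
  exact V.mem_nonunits_iff.mp this

section
variable {Γ₀ : Type*} [LinearOrderedCommGroupWithZero Γ₀]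

theorem valuation_intCast_le_one {K : Type*} [Field K] (v : Valuation K Γ₀) (n : ℤ) :
    v (n : K) ≤ 1 := by
  induction n using Int.induction_on with
  | zero => simp
  | succ n ih =>
    push_cast at ih ⊢
    exact (v.map_add _ _).trans (max_le ih v.map_one.le)
  | pred n ih =>
    push_cast at ih ⊢
    exact (v.map_sub _ _).trans (max_le ih v.map_one.le)

theorem valuation_eq_one_of_pow_eq_one {K : Type*} [Field K] (v : Valuation K Γ₀) {x : K} {n : ℕ}
    (hn : n ≠ 0) (h : x ^ n = 1) : v x = 1 := by
  have := congrArg v h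
  rw [map_pow, map_one] at this
  exact (pow_eq_one_iff_of_nonneg zero_le hn).mp this

/-- A root of unity congruent to `1` modulo `4` is equal to `1`. -/
theorem eq_one_of_pow_eq_one_of_valuation_le {K : Type*} [Field K] [CharZero K]
    (v : Valuation K Γ₀) (h2 : v 2 < 1) {x : K} {n : ℕ} (hn : n ≠ 0) (h : x ^ n = 1)
    (hx : v (x - 1) ≤ v 4) : x = 1 := by
  have h20 : 0 < v 2 := by
    rw [zero_lt_iff, Valuation.ne_zero_iff]; norm_num
  have h42 : v 4 < v 2 := by
    have : (4 : K) = 2 * 2 := by norm_num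
    rw [this, map_mul]
    exact mul_lt_of_lt_one_left h20 h2
  have hx1 : v x = 1 := valuation_eq_one_of_pow_eq_one v hn h
  have hpow : ∀ m : ℕ, v (x ^ m - 1) ≤ v (x - 1) := by
    intro m
    induction m with
    | zero => simp
    | succ m ih =>
      have : x ^ (m + 1) - 1 = x * (x ^ m - 1) + (x - 1) := by ring
      rw [this]
      refine (v.map_add _ _).trans (max_le ?_ le_rfl)
      rwa [map_mul, hx1, one_mul]
  induction n using Nat.strong_induction_on with
  | _ n ih =>
    rcases Nat.even_or_odd' n with ⟨m, rfl | rfl⟩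
    · have hsq : (x ^ m - 1) * (x ^ m + 1) = 0 := by
        have : x ^ (2 * m) = (x ^ m) ^ 2 := by rw [mul_comm, pow_mul]
        rw [this] at h
        linear_combination h
      -- Either the exponent can be halved, or x^m = -1, which would force v 2 ≤ v 4.
      rcases mul_eq_zero.mp hsq with h' | h'
      · exact ih m (by omega) (by omega) (sub_eq_zero.mp h')
      · have h3 := hpow m
        rw [show x ^ m - 1 = -2 by linear_combination h', Valuation.map_neg] at h3
        exact absurd (h3.trans hx) (not_le.mpr h42)
    -- For odd exponent the geometric sum vanishes, yet each term is 1 modulo the maximal ideal, so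
    -- the odd number 2m + 1 would have valuation below 1.
    · by_contra hne
      have hgeom : ∑ i ∈ Finset.range (2 * m + 1), x ^ i = 0 := by
        have := mul_geom_sum x (2 * m + 1)
        rw [h, sub_self] at this
        exact (mul_eq_zero.mp this).resolve_left (sub_ne_zero.mpr hne)
      have hsum : v (∑ i ∈ Finset.range (2 * m + 1), (x ^ i - 1)) < 1 := by
        refine v.map_sum_lt one_ne_zero fun i _ => ?_
        exact ((hpow i).trans hx).trans_lt (h42.trans h2)
      rw [Finset.sum_sub_distrib, hgeom] at hsum
      simp only [Finset.sum_const, Finset.card_range, nsmul_eq_mul, mul_one, zero_sub,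
        Valuation.map_neg] at hsum
      have h2m : v ((2 : K) * (m : ℤ)) < 1 := by
        rw [map_mul]
        exact (mul_le_of_le_one_right zero_le (valuation_intCast_le_one v m)).trans_lt h2
      have := v.map_one_add_of_lt h2m
      rw [← this] at hsum
      refine hsum.ne ?_
      congr 1
      push_cast
      ring

/-- If `x` is a root of unity other than `±1` then `1 - x` divides `2` properly in the ring of
integers of a `2`-adic valuation. -/
theorem valuation_two_lt_of_pow_eq_one {K : Type*} [Field K] [CharZero K]
    (v : Valuation K Γ₀) (h2 : v 2 < 1) {x : K} {n : ℕ} (hn : n ≠ 0) (h : x ^ n = 1)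
    (hx : x ^ 2 ≠ 1) : v 2 < v (x - 1) := by
  by_contra! hle
  -- If x ≡ 1 mod 2 then x² ≡ 1 mod 4, so the previous lemma applies to x².
  refine hx (eq_one_of_pow_eq_one_of_valuation_le v h2 hn
    (by rw [← pow_mul, mul_comm, pow_mul, h, one_pow]) ?_)
  have e : x ^ 2 - 1 = (x - 1) * ((x - 1) + 2) := by ring
  rw [e, map_mul, show (4 : K) = 2 * 2 by norm_num, map_mul]
  exact mul_le_mul' hle ((v.map_add _ _).trans (max_le hle le_rfl))

/-- The cosine of a rational angle that is not a multiple of `π / 2` is `2`-adically large. -/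
theorem one_lt_valuation_cos (v : Valuation ℂ Γ₀) (h2 : v 2 < 1) {q : ℕ} (hq : q ≠ 0)
    {b : ℤ} (hb : ¬ (q : ℤ) ∣ 4 * b) :
    1 < v (Real.cos (2 * Real.pi / q * b) : ℂ) := by
  set θ : ℝ := 2 * Real.pi / q * b
  set z : ℂ := Complex.exp (θ * Complex.I) with hz
  have hqC : (q : ℂ) ≠ 0 := by exact_mod_cast hq
  have hzq : z ^ q = 1 := by
    rw [hz, ← Complex.exp_nat_mul, Complex.exp_eq_one_iff]
    refine ⟨b, ?_⟩
    simp only [θ]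
    push_cast
    field_simp
  have hz4 : z ^ 4 ≠ 1 := by
    rw [hz, ← Complex.exp_nat_mul, Ne, Complex.exp_eq_one_iff]
    rintro ⟨n, hn⟩
    refine hb ⟨n, ?_⟩
    have hpi : (2 * Real.pi * Complex.I : ℂ) ≠ 0 := Complex.two_pi_I_ne_zero
    simp only [θ] at hn
    push_cast at hn
    field_simp at hn
    have : ((4 * b : ℤ) : ℂ) = ((q * n : ℤ) : ℂ) := by push_cast; linear_combination hn
    exact_mod_cast this
  have hz0 : z ≠ 0 := Complex.exp_ne_zero _
  have hzinv : Complex.exp (-(θ * Complex.I)) = z⁻¹ := Complex.exp_neg _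
  have hvz : v z = 1 := valuation_eq_one_of_pow_eq_one v hq hzq
  have key : ∀ w : ℂ, v 2 < v (2 * w) → 1 < v w := by
    intro w hw
    rw [map_mul] at hw
    by_contra! hle
    exact absurd hw (not_lt.mpr (mul_le_of_le_one_right zero_le hle))
  apply key
  -- This is 2 cos θ · z = z² + 1, written so that the root of unity -z² is compared with 1; its
  -- square is not 1 because z⁴ ≠ 1.
  have e : 2 * (Real.cos θ : ℂ) * z = -((-z ^ 2) - 1) := by
    rw [Complex.ofReal_cos, Complex.two_cos, neg_mul, hzinv]
    field_simp
    ring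
  have h3 := congrArg v e
  rw [map_mul, hvz, mul_one, Valuation.map_neg] at h3
  rw [h3]
  refine valuation_two_lt_of_pow_eq_one v h2 (n := 2 * q) (by omega) ?_ ?_
  · rw [pow_mul, neg_sq, show ((z ^ 2) ^ 2) ^ q = (z ^ q) ^ 4 by ring, hzq, one_pow]
  · rw [neg_sq, ← pow_mul]; exact hz4

end

/-! ### Coset representatives and normal words. -/

/-- `a ∈ (-P/2, P/2]`. -/
def IsRepA (P a : ℤ) : Prop := -P < 2 * a ∧ 2 * a ≤ P

/-- `b ∈ (-Q/2, Q/2)`. -/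
def IsRepB (Q b : ℤ) : Prop := -Q < 2 * b ∧ 2 * b < Q

theorem exists_isRepA {P : ℤ} (hP : 0 < P) (a : ℤ) : ∃ a' m, IsRepA P a' ∧ a = a' + P * m := by
  have h0 := Int.emod_nonneg a hP.ne'
  have h1 := Int.emod_lt_of_pos a hP
  have h2 := Int.emod_add_mul_ediv a P
  by_cases h : 2 * (a % P) ≤ P
  · exact ⟨a % P, a / P, ⟨by omega, h⟩, h2.symm⟩
  · exact ⟨a % P - P, a / P + 1, ⟨by omega, by omega⟩, by linarith⟩

theorem IsRepA.eq_of_dvd {P a a' : ℤ} (h : IsRepA P a) (h' : IsRepA P a') (hd : P ∣ a - a') :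
    a = a' := by
  unfold IsRepA at h h'
  refine sub_eq_zero.mp (Int.eq_zero_of_abs_lt_dvd hd ?_)
  rw [abs_lt]
  constructor <;> linarith

theorem IsRepB.isRepA {Q b : ℤ} (h : IsRepB Q b) : IsRepA Q b := ⟨h.1, h.2.le⟩

theorem exists_isRepB {Q : ℤ} (hQ : 0 < Q) (hodd : Odd Q) (b : ℤ) :
    ∃ b' m, IsRepB Q b' ∧ b = b' + Q * m := by
  obtain ⟨b', m, h, e⟩ := exists_isRepA hQ b
  refine ⟨b', m, ⟨h.1, lt_of_le_of_ne h.2 ?_⟩, e⟩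
  obtain ⟨k, rfl⟩ := hodd
  omega

theorem IsRepB.eq_of_dvd {Q b b' : ℤ} (h : IsRepB Q b) (h' : IsRepB Q b') (hd : Q ∣ b - b') :
    b = b' := h.isRepA.eq_of_dvd h'.isRepA hd

/-- The open interval is symmetric. The half-open one for A is not: its endpoint P/2 changes class
representative under a sign, which is what produces the extra powers of A^P below. -/
theorem IsRepB.sign_mul {Q b s : ℤ} (h : IsRepB Q b) (hs : s = 1 ∨ s = -1) :
    IsRepB Q (s * b) := by
  unfold IsRepB at *
  rcases hs with rfl | rfl <;> constructor <;> linarith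

theorem isRepA_zero {P : ℤ} (hP : 0 < P) : IsRepA P 0 := ⟨by omega, by omega⟩

theorem isRepB_zero {Q : ℤ} (hQ : 0 < Q) : IsRepB Q 0 := ⟨by omega, by omega⟩

theorem IsRepA.not_dvd {P a : ℤ} (h : IsRepA P a) (hP : 0 < P) (ha : a ≠ 0) : ¬ P ∣ a :=
  fun hd => ha (h.eq_of_dvd (isRepA_zero hP) (by simpa using hd))

theorem IsRepB.not_dvd {Q b : ℤ} (h : IsRepB Q b) (hQ : 0 < Q) (hb : b ≠ 0) : ¬ Q ∣ b :=
  fun hd => hb (h.eq_of_dvd (isRepB_zero hQ) (by simpa using hd))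

theorem sign_mul_ne_zero {s a : ℤ} (hs : s = 1 ∨ s = -1) (ha : a ≠ 0) : s * a ≠ 0 := by
  rcases hs with rfl | rfl <;> omega

theorem sign_mul_self {s : ℤ} (hs : s = 1 ∨ s = -1) : s * s = 1 := by
  rcases hs with rfl | rfl <;> rfl

/-- The words all of whose syllables are nontrivial coset representatives, except that the last
exponent may be `0`. -/
inductive IsTail (P Q : ℤ) : List (ℤ × ℤ) → Prop
  | nil : IsTail P Q []
  | cons {a b : ℤ} {r : List (ℤ × ℤ)} (ha : IsRepA P a) (ha0 : a ≠ 0) (hb : IsRepB Q b)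
      (hb0 : b ≠ 0 ∨ r = []) (hr : IsTail P Q r) : IsTail P Q ((a, b) :: r)

/-- The nonempty words all of whose syllables are nontrivial coset representatives, except that
the first and the last exponent may be `0`. -/
inductive IsNormal (P Q : ℤ) : List (ℤ × ℤ) → Prop
  | cons {a b : ℤ} {r : List (ℤ × ℤ)} (ha : IsRepA P a) (hb : IsRepB Q b)
      (hb0 : b ≠ 0 ∨ r = []) (hr : IsTail P Q r) : IsNormal P Q ((a, b) :: r)

theorem IsTail.isNormal {P Q : ℤ} {r : List (ℤ × ℤ)} (h : IsTail P Q r) (hr : r ≠ []) :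
    IsNormal P Q r := by
  cases h with
  | nil => exact absurd rfl hr
  | cons ha ha0 hb hb0 ht => exact .cons ha hb hb0 ht

/-- The value of a word in a group with two distinguished elements. -/
def evalWord {Γ : Type*} [Group Γ] (A B : Γ) (w : List (ℤ × ℤ)) : Γ :=
  (w.map fun x => A ^ x.1 * B ^ x.2).prod

section
variable {Γ : Type*} [Group Γ] (A B : Γ)

@[simp] theorem evalWord_nil : evalWord A B [] = 1 := rfl

@[simp] theorem evalWord_cons (x : ℤ × ℤ) (r : List (ℤ × ℤ)) :
    evalWord A B (x :: r) = A ^ x.1 * (B ^ x.2 * evalWord A B r) := by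
  simp [evalWord, mul_assoc]

@[simp] theorem evalWord_append (r r' : List (ℤ × ℤ)) :
    evalWord A B (r ++ r') = evalWord A B r * evalWord A B r' := by
  simp [evalWord]

end

/-! ### The abstract ping-pong setting and its core. -/

/-- Elements `A`, `B` of a group, of orders `2 * P` and `q`, such that `A ^ P` inverts `B` and
`B ^ Q` inverts or centralizes `A`, together with ping-pong sets that witness that there are no
further relations. -/
structure PingPong {Γ : Type*} [Group Γ] (A B : Γ) (P Q q : ℤ) where
  P_pos : 0 < P
  Q_pos : 0 < Q
  Q_odd : Odd Q
  q_eq : q = Q ∨ q = 2 * Q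
  zpow_A : A ^ (2 * P) = 1
  zpow_B : B ^ q = 1
  dvd_of_mul_eq_one : ∀ a b : ℤ, A ^ a * B ^ b = 1 → 2 * P ∣ a ∧ q ∣ b
  zpow_P_mul : ∀ b : ℤ, A ^ P * B ^ b = B ^ (-b) * A ^ P
  zpow_Q_mul : ∃ s : ℤ, (s = 1 ∨ s = -1) ∧ ∀ a : ℤ, B ^ Q * A ^ a = A ^ (s * a) * B ^ Q
  /-- the base set -/
  E : Set Γ
  /-- the set that nontrivial powers of `B` move into `V` -/
  U : Set Γ
  /-- the set that nontrivial powers of `A` move into `U \ E` -/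
  V : Set Γ
  zpow_mul_zpow_mem_E : ∀ m n : ℤ, A ^ (P * m) * B ^ (Q * n) ∈ E
  zpow_A_mul_mem_E : ∀ (a : ℤ) (g : Γ), g ∈ E → A ^ a * g ∈ E
  E_subset_U : E ⊆ U
  notMem_V_of_mem_U : ∀ g ∈ U, g ∉ V
  zpow_B_mul_mem_V : ∀ (b : ℤ) (g : Γ), ¬ Q ∣ b → g ∈ U → B ^ b * g ∈ V
  zpow_A_mul_mem_U : ∀ (a : ℤ) (g : Γ), ¬ P ∣ a → g ∈ V → A ^ a * g ∈ U ∧ A ^ a * g ∉ E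

namespace PingPong
variable {Γ : Type*} [Group Γ] {A B : Γ} {P Q q : ℤ} (D : PingPong A B P Q q)
include D

theorem exists_sign_of_zpow_A (m : ℤ) : ∃ t : ℤ, (t = 1 ∨ t = -1) ∧
    ∀ b : ℤ, A ^ (P * m) * B ^ b = B ^ (t * b) * A ^ (P * m) := by
  have h2 : ∀ n : ℤ, A ^ (P * (2 * n)) = 1 := fun n => by
    rw [show P * (2 * n) = 2 * P * n by ring, zpow_mul, D.zpow_A, one_zpow]
  rcases Int.even_or_odd' m with ⟨n, rfl | rfl⟩
  · exact ⟨1, .inl rfl, fun b => by simp [h2]⟩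
  · refine ⟨-1, .inr rfl, fun b => ?_⟩
    rw [mul_add, zpow_add, h2, one_mul, mul_one, D.zpow_P_mul, neg_one_mul]

theorem exists_sign_of_zpow_B (n : ℤ) : ∃ s : ℤ, (s = 1 ∨ s = -1) ∧
    ∀ a : ℤ, B ^ (Q * n) * A ^ a = A ^ (s * a) * B ^ (Q * n) := by
  have h2 : ∀ m : ℤ, B ^ (Q * (2 * m)) = 1 := fun m => by
    rcases D.q_eq with h | h
    · rw [← h, zpow_mul, D.zpow_B, one_zpow]
    · rw [show Q * (2 * m) = q * m by rw [h]; ring, zpow_mul, D.zpow_B, one_zpow]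
  rcases Int.even_or_odd' n with ⟨m, rfl | rfl⟩
  · exact ⟨1, .inl rfl, fun b => by simp [h2]⟩
  · obtain ⟨s, hs, h⟩ := D.zpow_Q_mul
    exact ⟨s, hs, fun a => by rw [mul_add, zpow_add, h2, one_mul, mul_one, h]⟩

/-- Even if B^(Qn) inverts A, it fixes A^(Pm), whose square is 1. -/
theorem commute_zpow (m n : ℤ) : A ^ (P * m) * B ^ (Q * n) = B ^ (Q * n) * A ^ (P * m) := by
  obtain ⟨s, hs, h⟩ := D.exists_sign_of_zpow_B n
  rw [h]
  rcases hs with rfl | rfl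
  · rw [one_mul]
  · congr 1
    have : A ^ (P * m) * A ^ (P * m) = 1 := by
      rw [← zpow_add, show P * m + P * m = 2 * P * m by ring, zpow_mul, D.zpow_A, one_zpow]
    rw [neg_one_mul, zpow_neg]
    exact eq_inv_of_mul_eq_one_left this

/-- The amalgamated subgroup, generated by `A ^ P` and `B ^ Q`. -/
def core : Subgroup Γ where
  carrier := {g | ∃ m n : ℤ, g = A ^ (P * m) * B ^ (Q * n)}
  one_mem' := ⟨0, 0, by simp⟩
  mul_mem' := by
    rintro _ _ ⟨m, n, rfl⟩ ⟨m', n', rfl⟩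
    refine ⟨m + m', n + n', ?_⟩
    rw [mul_assoc, ← mul_assoc (B ^ _), ← D.commute_zpow, mul_add, mul_add, zpow_add, zpow_add]
    simp only [mul_assoc]
  inv_mem' := by
    rintro _ ⟨m, n, rfl⟩
    refine ⟨-m, -n, ?_⟩
    rw [D.commute_zpow, mul_inv_rev, mul_neg, mul_neg, zpow_neg, zpow_neg]

theorem zpow_A_mem_core (m : ℤ) : A ^ (P * m) ∈ D.core := ⟨m, 0, by simp⟩

theorem zpow_B_mem_core (n : ℤ) : B ^ (Q * n) ∈ D.core := ⟨0, n, by simp⟩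

theorem mem_E_of_mem_core {k : Γ} (hk : k ∈ D.core) : k ∈ D.E := by
  obtain ⟨m, n, rfl⟩ := hk
  exact D.zpow_mul_zpow_mem_E m n

theorem dvd_of_zpow_A_mem_core {a : ℤ} (h : A ^ a ∈ D.core) : P ∣ a := by
  obtain ⟨m, n, h⟩ := h
  have : A ^ (a - P * m) * B ^ (-(Q * n)) = 1 := by
    rw [sub_eq_neg_add, zpow_add, h, zpow_neg, zpow_neg]
    simp
  have h2 := (Dvd.intro_left 2 rfl).trans (D.dvd_of_mul_eq_one _ _ this).1
  exact (dvd_sub_left (Dvd.intro m rfl)).mp h2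

theorem exists_sign_A_of_mem_core {k : Γ} (hk : k ∈ D.core) : ∃ s : ℤ, (s = 1 ∨ s = -1) ∧
    ∀ a : ℤ, k * A ^ a = A ^ (s * a) * k := by
  obtain ⟨m, n, rfl⟩ := hk
  obtain ⟨s, hs, h⟩ := D.exists_sign_of_zpow_B n
  exact ⟨s, hs, fun a => by
    rw [mul_assoc, h, ← mul_assoc, ← mul_assoc, ← zpow_add, ← zpow_add, add_comm]⟩

theorem exists_sign_B_of_mem_core {k : Γ} (hk : k ∈ D.core) : ∃ t : ℤ, (t = 1 ∨ t = -1) ∧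
    ∀ b : ℤ, k * B ^ b = B ^ (t * b) * k := by
  obtain ⟨m, n, rfl⟩ := hk
  obtain ⟨t, ht, h⟩ := D.exists_sign_of_zpow_A m
  refine ⟨t, ht, fun b => ?_⟩
  rw [mul_assoc, ← zpow_add, add_comm, zpow_add, ← mul_assoc, h, mul_assoc]

theorem core_comm {k k' : Γ} (hk : k ∈ D.core) (hk' : k' ∈ D.core) : k * k' = k' * k := by
  obtain ⟨m, n, rfl⟩ := hk
  obtain ⟨m', n', rfl⟩ := hk'
  have h1 := D.commute_zpow m n
  have h2 := D.commute_zpow m' n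
  have h3 := D.commute_zpow m n'
  have h4 := D.commute_zpow m' n'
  have c1 : Commute (A ^ (P * m)) (A ^ (P * m') * B ^ (Q * n')) :=
    (Commute.zpow_zpow_self A _ _).mul_right h3
  have c2 : Commute (B ^ (Q * n)) (A ^ (P * m') * B ^ (Q * n')) :=
    Commute.mul_right h2.symm (Commute.zpow_zpow_self B _ _)
  exact c1.mul_left c2

/-! ### Existence of normal words. -/

/-- The amalgamated subgroup can be moved past a syllable pair, at the cost of a power of
`A ^ P`. -/
theorem exists_core_mul_pair {k : Γ} (hk : k ∈ D.core) {a b : ℤ} (hb : IsRepB Q b) :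
    ∃ a' b' m : ℤ, IsRepA P a' ∧ IsRepB Q b' ∧ (¬ P ∣ a → a' ≠ 0) ∧ (b ≠ 0 → b' ≠ 0) ∧
      k * (A ^ a * B ^ b) = A ^ a' * B ^ b' * (k * A ^ (P * m)) := by
  obtain ⟨s, hs, h⟩ := D.exists_sign_A_of_mem_core hk
  obtain ⟨a', m, ha', e⟩ := exists_isRepA D.P_pos (s * a)
  have hk' : k * A ^ (P * m) ∈ D.core := mul_mem hk (D.zpow_A_mem_core m)
  -- The power of A^P split off from A^(sa) must cross B^b together with k, so the sign is that of
  -- the product.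
  obtain ⟨t, ht, h'⟩ := D.exists_sign_B_of_mem_core hk'
  refine ⟨a', t * b, m, ha', hb.sign_mul ht, ?_, sign_mul_ne_zero ht, ?_⟩
  · rintro hd rfl
    refine hd ?_
    have : P ∣ s * a := ⟨m, by rw [e, zero_add]⟩
    rcases hs with rfl | rfl <;> simpa using this
  · rw [mul_assoc, ← h', ← mul_assoc, h, e, zpow_add, mul_assoc (A ^ a'),
      D.core_comm (D.zpow_A_mem_core m) hk]
    simp only [mul_assoc]

/-- The power of A^P released by one syllable joins k before the next. Emptiness is tracked because
only a last B-exponent may vanish. -/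
theorem exists_core_mul_tail {r : List (ℤ × ℤ)} (hr : IsTail P Q r) :
    ∀ k ∈ D.core, ∃ (r' : List (ℤ × ℤ)) (m : ℤ), IsTail P Q r' ∧ (r = [] ↔ r' = []) ∧
      k * evalWord A B r = evalWord A B r' * (k * A ^ (P * m)) := by
  induction hr with
  | nil => exact fun k _ => ⟨[], 0, .nil, by simp, by simp⟩
  | @cons a b r ha ha0 hb hb0 hr ih =>
    intro k hk
    obtain ⟨a', b', m, ha', hb', ha0', hb0', h⟩ := D.exists_core_mul_pair hk (a := a) hb
    obtain ⟨r', m', hr', hn, h'⟩ := ih _ (mul_mem hk (D.zpow_A_mem_core m))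
    refine ⟨(a', b') :: r', m + m', .cons ha' (ha0' (ha.not_dvd D.P_pos ha0)) hb'
      (hb0.imp hb0' hn.mp) hr', by simp, ?_⟩
    calc k * evalWord A B ((a, b) :: r) = k * (A ^ a * B ^ b) * evalWord A B r := by
          simp [mul_assoc]
      _ = A ^ a' * B ^ b' * (k * A ^ (P * m) * evalWord A B r) := by rw [h]; simp [mul_assoc]
      _ = _ := by rw [h', mul_add, zpow_add]; simp [mul_assoc]

theorem exists_core_mul_normal {w : List (ℤ × ℤ)} (hw : IsNormal P Q w) {k : Γ}
    (hk : k ∈ D.core) : ∃ (w' : List (ℤ × ℤ)) (m : ℤ), IsNormal P Q w' ∧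
      k * evalWord A B w = evalWord A B w' * (k * A ^ (P * m)) := by
  cases hw with
  | @cons a b r ha hb hb0 hr =>
    obtain ⟨a', b', m, ha', hb', -, hb0', h⟩ := D.exists_core_mul_pair hk (a := a) hb
    obtain ⟨r', m', hr', hn, h'⟩ :=
      D.exists_core_mul_tail hr _ (mul_mem hk (D.zpow_A_mem_core m))
    refine ⟨(a', b') :: r', m + m', .cons ha' hb' (hb0.imp hb0' hn.mp) hr', ?_⟩
    calc k * evalWord A B ((a, b) :: r) = k * (A ^ a * B ^ b) * evalWord A B r := by
          simp [mul_assoc]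
      _ = A ^ a' * B ^ b' * (k * A ^ (P * m) * evalWord A B r) := by rw [h]; simp [mul_assoc]
      _ = _ := by rw [h', mul_add, zpow_add]; simp [mul_assoc]

theorem exists_zpow_B_mul_tail {r : List (ℤ × ℤ)} (hr : IsTail P Q r) (b : ℤ) {k : Γ}
    (hk : k ∈ D.core) : ∃ w, IsNormal P Q w ∧ ∃ k' ∈ D.core,
      B ^ b * evalWord A B r * k = evalWord A B w * k' := by
  obtain ⟨b', n, hb', rfl⟩ := exists_isRepB D.Q_pos D.Q_odd b
  obtain ⟨r', m, hr', hn, h⟩ := D.exists_core_mul_tail hr _ (D.zpow_B_mem_core n)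
  have hk' : B ^ (Q * n) * A ^ (P * m) * k ∈ D.core :=
    mul_mem (mul_mem (D.zpow_B_mem_core n) (D.zpow_A_mem_core m)) hk
  have e : B ^ (b' + Q * n) * evalWord A B r * k =
      B ^ b' * evalWord A B r' * (B ^ (Q * n) * A ^ (P * m) * k) := by
    rw [zpow_add, mul_assoc (B ^ b'), h]
    simp only [mul_assoc]
  rw [e]
  -- A vanishing B-exponent in front of a nonempty tail is not allowed; the tail alone is then the
  -- normal word.
  by_cases hc : b' ≠ 0 ∨ r' = []
  · exact ⟨(0, b') :: r', .cons (isRepA_zero D.P_pos) hb' hc hr', _, hk', by simp⟩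
  · push Not at hc
    exact ⟨r', hr'.isNormal hc.2, _, hk', by simp [hc.1]⟩

/-- Every element of the group generated by `A` and `B` is a normal word times an element of the
amalgamated subgroup. -/
theorem exists_normal {g : Γ} (hg : g ∈ Subgroup.closure {A, B}) :
    ∃ w, IsNormal P Q w ∧ ∃ k ∈ D.core, g = evalWord A B w * k := by
  have hA : ∀ (a : ℤ) (g : Γ), (∃ w, IsNormal P Q w ∧ ∃ k ∈ D.core, g = evalWord A B w * k) →
      ∃ w, IsNormal P Q w ∧ ∃ k ∈ D.core, A ^ a * g = evalWord A B w * k := by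
    rintro a _ ⟨_, @⟨a₁, b₁, r, ha₁, hb₁, hb0, hr⟩, k, hk, rfl⟩
    obtain ⟨a', b', m, ha', hb', -, hb0', h⟩ :=
      D.exists_core_mul_pair D.core.one_mem (a := a + a₁) hb₁
    obtain ⟨r', m', hr', hn, h'⟩ := D.exists_core_mul_tail hr _ (D.zpow_A_mem_core m)
    refine ⟨(a', b') :: r', .cons ha' hb' (hb0.imp hb0' hn.mp) hr',
      A ^ (P * m) * A ^ (P * m') * k,
      mul_mem (mul_mem (D.zpow_A_mem_core m) (D.zpow_A_mem_core m')) hk, ?_⟩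
    rw [one_mul, one_mul] at h
    calc A ^ a * (evalWord A B ((a₁, b₁) :: r) * k)
        = A ^ (a + a₁) * B ^ b₁ * evalWord A B r * k := by simp [mul_assoc, zpow_add]
      _ = A ^ a' * B ^ b' * (A ^ (P * m) * evalWord A B r) * k := by rw [h]; simp [mul_assoc]
      _ = _ := by rw [h']; simp [mul_assoc]
  have hB : ∀ (b : ℤ) (g : Γ), (∃ w, IsNormal P Q w ∧ ∃ k ∈ D.core, g = evalWord A B w * k) →
      ∃ w, IsNormal P Q w ∧ ∃ k ∈ D.core, B ^ b * g = evalWord A B w * k := by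
    rintro b _ ⟨_, @⟨a₁, b₁, r, ha₁, hb₁, hb0, hr⟩, k, hk, rfl⟩
    -- With a₁ = 0 the new power of B merges with B^b₁; otherwise the whole word is a tail.
    by_cases ha : a₁ = 0
    · subst ha
      have := D.exists_zpow_B_mul_tail hr (b + b₁) hk
      simpa [mul_assoc, zpow_add] using this
    · have := D.exists_zpow_B_mul_tail (.cons ha₁ ha hb₁ hb0 hr) b hk
      simpa [mul_assoc] using this
  induction hg using Subgroup.closure_induction_left with
  | one =>
    exact ⟨[(0, 0)], .cons (isRepA_zero D.P_pos) (isRepB_zero D.Q_pos) (.inr rfl) .nil, 1,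
      one_mem _, by simp⟩
  | mul_left x hx y _ ih =>
    rcases hx with rfl | rfl
    · simpa using hA 1 y ih
    · simpa using hB 1 y ih
  | inv_mul_cancel x hx y _ ih =>
    rcases hx with rfl | rfl
    · simpa using hA (-1) y ih
    · simpa using hB (-1) y ih

/-! ### Uniqueness of normal words. -/

/-- Reading the word from the right, one starts at k in E ⊆ U; powers of B move U to V and powers of
A move V back to U. A last B-exponent 0 is harmless since powers of A preserve E. -/
theorem zpow_B_mul_tail_mem {r : List (ℤ × ℤ)} (hr : IsTail P Q r) {k : Γ} (hk : k ∈ D.core) :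
    evalWord A B r * k ∈ D.U ∧ ∀ b, IsRepB Q b → (b ≠ 0 ∨ r = []) →
      (b = 0 ∧ r = []) ∨ B ^ b * (evalWord A B r * k) ∈ D.V := by
  have hU : ∀ r, evalWord A B r * k ∈ D.U →
      ∀ b, IsRepB Q b → (b ≠ 0 ∨ r = []) →
      (b = 0 ∧ r = []) ∨ B ^ b * (evalWord A B r * k) ∈ D.V := by
    intro r hr b hb h
    by_cases hb0 : b = 0
    · exact .inl ⟨hb0, h.resolve_left (not_not.mpr hb0)⟩
    · exact .inr (D.zpow_B_mul_mem_V b _ (hb.not_dvd D.Q_pos hb0) hr)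
  suffices evalWord A B r * k ∈ D.U from ⟨this, hU r this⟩
  induction hr with
  | nil => simpa using D.E_subset_U (D.mem_E_of_mem_core hk)
  | @cons a b r ha ha0 hb hb0 hr ih =>
    rcases hU r ih b hb hb0 with ⟨rfl, rfl⟩ | h
    · simpa using D.E_subset_U (D.zpow_A_mul_mem_E a k (D.mem_E_of_mem_core hk))
    · simpa [mul_assoc] using (D.zpow_A_mul_mem_U a _ (ha.not_dvd D.P_pos ha0) h).1

/-- Otherwise P does not divide a₁ - a₂, and A^(a₁ - a₂) sends a point of V into U \ E, whereas the
other side is 1 ∈ E or lies in V. If the left word is just k, the image stays in E, so the other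
side must be 1 and A^(a₁ - a₂) would be in the core. -/
theorem zpow_A_eq_of_eq {a₁ a₂ b₁ b₂ : ℤ} {r₁ r₂ : List (ℤ × ℤ)} {k : Γ} (hk : k ∈ D.core)
    (ha₁ : IsRepA P a₁) (ha₂ : IsRepA P a₂) (hb₁ : IsRepB Q b₁) (hb₂ : IsRepB Q b₂)
    (h₁ : b₁ ≠ 0 ∨ r₁ = []) (h₂ : b₂ ≠ 0 ∨ r₂ = []) (hr₁ : IsTail P Q r₁) (hr₂ : IsTail P Q r₂)
    (h : A ^ a₁ * (B ^ b₁ * (evalWord A B r₁ * k)) = A ^ a₂ * (B ^ b₂ * evalWord A B r₂)) :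
    a₁ = a₂ := by
  by_contra hne
  have hnd : ¬ P ∣ a₁ - a₂ := fun hd => hne (ha₁.eq_of_dvd ha₂ hd)
  have e : A ^ (a₁ - a₂) * (B ^ b₁ * (evalWord A B r₁ * k)) = B ^ b₂ * evalWord A B r₂ := by
    rw [sub_eq_neg_add, zpow_add, mul_assoc, h, zpow_neg, inv_mul_cancel_left]
  have m₁ := (D.zpow_B_mul_tail_mem hr₁ hk).2 b₁ hb₁ h₁
  have m₂ := (D.zpow_B_mul_tail_mem hr₂ D.core.one_mem).2 b₂ hb₂ h₂
  rw [mul_one] at m₂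
  have h1 : (1 : Γ) ∈ D.E := D.mem_E_of_mem_core D.core.one_mem
  rcases m₁ with ⟨rfl, rfl⟩ | m₁
  · simp only [zpow_zero, evalWord_nil, one_mul] at e
    rcases m₂ with ⟨rfl, rfl⟩ | m₂
    · simp only [zpow_zero, evalWord_nil, one_mul] at e
      apply hnd
      apply D.dvd_of_zpow_A_mem_core
      rw [eq_inv_of_mul_eq_one_left e]
      exact inv_mem hk
    · rw [← e] at m₂
      exact D.notMem_V_of_mem_U _
        (D.E_subset_U (D.zpow_A_mul_mem_E _ _ (D.mem_E_of_mem_core hk))) m₂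
  · obtain ⟨u, ne⟩ := D.zpow_A_mul_mem_U _ _ hnd m₁
    rw [e] at u ne
    rcases m₂ with ⟨rfl, rfl⟩ | m₂
    · exact ne (by simpa using h1)
    · exact D.notMem_V_of_mem_U _ u m₂

theorem tail_mul_core_ne_core {a b : ℤ} {r : List (ℤ × ℤ)} (hr : IsTail P Q ((a, b) :: r))
    {k k' : Γ} (hk : k ∈ D.core) (hk' : k' ∈ D.core) :
    evalWord A B ((a, b) :: r) * k ≠ k' := by
  intro h
  have h0 : A ^ a * (B ^ b * (evalWord A B r * (k * k'⁻¹))) =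
      A ^ (0 : ℤ) * (B ^ (0 : ℤ) * evalWord A B []) := by
    simp only [zpow_zero, evalWord_nil, mul_one, ← mul_assoc]
    rw [← mul_inv_eq_one] at h
    simpa [mul_assoc] using h
  cases hr with
  | cons ha ha0 hb hb0 hr =>
    exact ha0 (D.zpow_A_eq_of_eq (mul_mem hk (inv_mem hk')) ha (isRepA_zero D.P_pos) hb
      (isRepB_zero D.Q_pos) hb0 (.inr rfl) hr .nil h0)

/-- Different exponents of B would carry one tail, a point of U, into V and onto the other tail,
again in U. After cancelling, the A-exponents agree by `zpow_A_eq_of_eq`, and induction continues.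
-/
theorem zpow_B_tail_eq_of_eq {r₁ : List (ℤ × ℤ)} (hr₁ : IsTail P Q r₁) {k : Γ}
    (hk : k ∈ D.core) : ∀ {b₁ b₂ : ℤ} {r₂ : List (ℤ × ℤ)}, IsTail P Q r₂ →
    IsRepB Q b₁ → IsRepB Q b₂ →
    B ^ b₁ * (evalWord A B r₁ * k) = B ^ b₂ * evalWord A B r₂ → b₁ = b₂ ∧ r₁ = r₂ := by
  have hB : ∀ {r₁ : List (ℤ × ℤ)}, IsTail P Q r₁ → ∀ {b₁ b₂ : ℤ} {r₂ : List (ℤ × ℤ)},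
      IsTail P Q r₂ → IsRepB Q b₁ → IsRepB Q b₂ →
      B ^ b₁ * (evalWord A B r₁ * k) = B ^ b₂ * evalWord A B r₂ → b₁ = b₂ := by
    intro r₁ hr₁ b₁ b₂ r₂ hr₂ hb₁ hb₂ h
    by_contra hne
    have hnd : ¬ Q ∣ b₁ - b₂ := fun hd => hne (hb₁.eq_of_dvd hb₂ hd)
    have e : B ^ (b₁ - b₂) * (evalWord A B r₁ * k) = evalWord A B r₂ := by
      rw [sub_eq_neg_add, zpow_add, mul_assoc, h, zpow_neg, inv_mul_cancel_left]
    have m₁ := D.zpow_B_mul_mem_V _ _ hnd (D.zpow_B_mul_tail_mem hr₁ hk).1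
    have m₂ := (D.zpow_B_mul_tail_mem hr₂ D.core.one_mem).1
    rw [e] at m₁
    rw [mul_one] at m₂
    exact D.notMem_V_of_mem_U _ m₂ m₁
  induction hr₁ with
  | nil =>
    intro b₁ b₂ r₂ hr₂ hb₁ hb₂ h
    obtain rfl := hB .nil hr₂ hb₁ hb₂ h
    refine ⟨rfl, ?_⟩
    cases r₂ with
    | nil => rfl
    | cons x r₂ =>
      refine absurd ?_ (D.tail_mul_core_ne_core hr₂ D.core.one_mem hk)
      simpa using (mul_left_cancel h).symm
  | @cons a b r ha ha0 hb hb0 hr ih =>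
    intro b₁ b₂ r₂ hr₂ hb₁ hb₂ h
    obtain rfl := hB (.cons ha ha0 hb hb0 hr) hr₂ hb₁ hb₂ h
    refine ⟨rfl, ?_⟩
    replace h := mul_left_cancel h
    cases hr₂ with
    | nil =>
      exact absurd h (D.tail_mul_core_ne_core (.cons ha ha0 hb hb0 hr) hk D.core.one_mem)
    | @cons a' b' r' ha' ha0' hb' hb0' hr' =>
      simp only [evalWord_cons, mul_assoc] at h
      obtain rfl := D.zpow_A_eq_of_eq hk ha ha' hb hb' hb0 hb0' hr hr' h
      obtain ⟨rfl, rfl⟩ := ih hr' hb hb' (mul_left_cancel h)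
      rfl

/-- The normal word of an element of the group is unique. -/
theorem normal_unique {w₁ w₂ : List (ℤ × ℤ)} (h₁ : IsNormal P Q w₁) (h₂ : IsNormal P Q w₂)
    {k₁ k₂ : Γ} (hk₁ : k₁ ∈ D.core) (hk₂ : k₂ ∈ D.core)
    (h : evalWord A B w₁ * k₁ = evalWord A B w₂ * k₂) : w₁ = w₂ ∧ k₁ = k₂ := by
  suffices w₁ = w₂ by
    subst this
    exact ⟨rfl, mul_left_cancel h⟩
  replace h : evalWord A B w₁ * (k₁ * k₂⁻¹) = evalWord A B w₂ := by
    rw [← mul_assoc, h, mul_inv_cancel_right]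
  have hk := mul_mem hk₁ (inv_mem hk₂)
  cases h₁ with
  | cons ha hb hb0 hr =>
    cases h₂ with
    | cons ha' hb' hb0' hr' =>
      rw [evalWord_cons, evalWord_cons, mul_assoc, mul_assoc] at h
      obtain rfl := D.zpow_A_eq_of_eq hk ha ha' hb hb' hb0 hb0' hr hr' h
      obtain ⟨rfl, rfl⟩ := D.zpow_B_tail_eq_of_eq hr hk hr' hb hb' (mul_left_cancel h)
      rfl

/-! ### Core factors on the left or split between both sides. -/

/-- Conjugation of a normal word by a power of `A ^ P` changes the signs of the exponents
of `B`. -/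
theorem exists_zpow_A_mul_normal (m : ℤ) : ∃ f : List (ℤ × ℤ) → List (ℤ × ℤ),
    Function.Involutive f ∧ (∀ w, IsNormal P Q w → IsNormal P Q (f w)) ∧
      ∀ w, A ^ (P * m) * evalWord A B w = evalWord A B (f w) * A ^ (P * m) := by
  obtain ⟨t, ht, h⟩ := D.exists_sign_of_zpow_A m
  refine ⟨List.map fun x => (x.1, t * x.2), fun w => ?_, fun w hw => ?_, fun w => ?_⟩
  · simp [Function.comp_def, ← mul_assoc, sign_mul_self ht]
  · have htail : ∀ r, IsTail P Q r → IsTail P Q (r.map fun x => (x.1, t * x.2)) := by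
      intro r hr
      induction hr with
      | nil => exact .nil
      | cons ha ha0 hb hb0 _ ih =>
        exact .cons ha ha0 (hb.sign_mul ht) (hb0.imp (sign_mul_ne_zero ht) (by simp_all)) ih
    cases hw with
    | cons ha hb hb0 hr =>
      exact .cons ha (hb.sign_mul ht) (hb0.imp (sign_mul_ne_zero ht) (by simp_all)) (htail _ hr)
  · induction w with
    | nil => simp
    | cons x w ih =>
      simp only [List.map_cons, evalWord_cons, mul_assoc]
      rw [← ih, ← mul_assoc (B ^ _), ← h, ← mul_assoc, ← mul_assoc (A ^ x.1), ← mul_assoc (A ^ x.1),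
        ← zpow_add, add_comm, zpow_add]
      simp only [mul_assoc]

/-- Conjugating the word by k leaves only a power of A^P on the right, and this passes back to the
left by sign changes alone. -/
theorem exists_left_normal {g : Γ} (hg : g ∈ Subgroup.closure {A, B}) :
    ∃ w, IsNormal P Q w ∧ ∃ k ∈ D.core, g = k * evalWord A B w := by
  obtain ⟨w, hw, k, hk, rfl⟩ := D.exists_normal hg
  obtain ⟨w', m, hw', h⟩ := D.exists_core_mul_normal hw (inv_mem hk)
  obtain ⟨f, hinv, hf, e⟩ := D.exists_zpow_A_mul_normal m
  refine ⟨f w', hf _ hw', k * A ^ (P * m), mul_mem hk (D.zpow_A_mem_core m), ?_⟩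
  rw [mul_assoc, e, hinv, inv_mul_eq_iff_eq_mul.mp h,
    D.core_comm (inv_mem hk) (D.zpow_A_mem_core m)]
  simp only [mul_assoc, inv_mul_cancel, mul_one]

/-- Moving k₂⁻¹k₁ across w₁ and using right uniqueness shows that it is a power of A^P. Such a power
crosses unchanged, so a second use of right uniqueness makes it 1. -/
theorem left_normal_unique {w₁ w₂ : List (ℤ × ℤ)} (h₁ : IsNormal P Q w₁) (h₂ : IsNormal P Q w₂)
    {k₁ k₂ : Γ} (hk₁ : k₁ ∈ D.core) (hk₂ : k₂ ∈ D.core)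
    (h : k₁ * evalWord A B w₁ = k₂ * evalWord A B w₂) : w₁ = w₂ ∧ k₁ = k₂ := by
  have hk := mul_mem (inv_mem hk₂) hk₁
  obtain ⟨w', m, hw', e⟩ := D.exists_core_mul_normal h₁ hk
  rw [mul_assoc, h, inv_mul_cancel_left] at e
  obtain ⟨-, e'⟩ := D.normal_unique h₂ hw' D.core.one_mem (mul_mem hk (D.zpow_A_mem_core m))
    (by rw [mul_one]; exact e)
  have hkm : k₂⁻¹ * k₁ = A ^ (P * -m) := by
    rw [mul_neg, zpow_neg]
    exact eq_inv_of_mul_eq_one_left e'.symm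
  obtain ⟨f, -, hf, ef⟩ := D.exists_zpow_A_mul_normal (-m)
  have e2 : evalWord A B w₂ * 1 = evalWord A B (f w₁) * A ^ (P * -m) := by
    rw [mul_one, ← ef, ← hkm, mul_assoc, h, inv_mul_cancel_left]
  have e3 := (D.normal_unique h₂ (hf _ h₁) D.core.one_mem (D.zpow_A_mem_core _) e2).2
  have : k₁ = k₂ := by
    rw [← e3] at hkm
    exact (inv_mul_eq_one.mp hkm).symm
  subst this
  refine ⟨?_, rfl⟩
  have := mul_left_cancel h
  exact (D.normal_unique h₁ h₂ D.core.one_mem D.core.one_mem (by rw [this])).1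

theorem exists_central_normal {g : Γ} (hg : g ∈ Subgroup.closure {A, B}) :
    ∃ w, IsNormal P Q w ∧ ∃ m n : ℤ, g = A ^ (P * m) * evalWord A B w * B ^ (Q * n) := by
  obtain ⟨w, hw, _, ⟨m, n, rfl⟩, rfl⟩ := D.exists_normal hg
  obtain ⟨f, hinv, hf, e⟩ := D.exists_zpow_A_mul_normal m
  refine ⟨f w, hf _ hw, m, n, ?_⟩
  rw [e, hinv, mul_assoc]

/-- Only the powers, not m and n, are determined. They separate because a product A^a B^b is 1 only
if both factors are. -/
theorem central_normal_unique {w₁ w₂ : List (ℤ × ℤ)} (h₁ : IsNormal P Q w₁)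
    (h₂ : IsNormal P Q w₂) {m₁ m₂ n₁ n₂ : ℤ}
    (h : A ^ (P * m₁) * evalWord A B w₁ * B ^ (Q * n₁) =
      A ^ (P * m₂) * evalWord A B w₂ * B ^ (Q * n₂)) :
    w₁ = w₂ ∧ A ^ (P * m₁) = A ^ (P * m₂) ∧ B ^ (Q * n₁) = B ^ (Q * n₂) := by
  obtain ⟨f₁, -, hf₁, e₁⟩ := D.exists_zpow_A_mul_normal m₁
  obtain ⟨f₂, -, hf₂, e₂⟩ := D.exists_zpow_A_mul_normal m₂
  have h' := h
  rw [e₁, e₂, mul_assoc, mul_assoc] at h'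
  obtain ⟨-, hk⟩ := D.normal_unique (hf₁ _ h₁) (hf₂ _ h₂) ⟨m₁, n₁, rfl⟩ ⟨m₂, n₂, rfl⟩ h'
  have hk' : A ^ (P * m₁ - P * m₂) * B ^ (Q * n₁ - Q * n₂) = 1 := by
    rw [sub_eq_neg_add, zpow_add, zpow_sub, mul_assoc, ← mul_assoc (A ^ (P * m₁)), hk]
    simp [zpow_neg, mul_assoc]
  obtain ⟨⟨c, hc⟩, ⟨d, hd⟩⟩ := D.dvd_of_mul_eq_one _ _ hk'
  have hA : A ^ (P * m₁) = A ^ (P * m₂) := by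
    rw [← mul_inv_eq_one, ← zpow_sub, hc, zpow_mul, D.zpow_A, one_zpow]
  have hB : B ^ (Q * n₁) = B ^ (Q * n₂) := by
    rw [← mul_inv_eq_one, ← zpow_sub, hd, zpow_mul, D.zpow_B, one_zpow]
  rw [hA, hB] at h
  have := mul_left_cancel (mul_right_cancel h)
  exact ⟨(D.normal_unique h₁ h₂ D.core.one_mem D.core.one_mem (by rw [this])).1, hA, hB⟩

end PingPong

/-! ### Rotation matrices. -/

theorem rotX_zero : rotX 0 = 1 := by
  apply Subtype.ext
  ext i j
  fin_cases i <;> fin_cases j <;> simp [rotX]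

theorem rotZ_zero : rotZ 0 = 1 := by
  apply Subtype.ext
  ext i j
  fin_cases i <;> fin_cases j <;> simp [rotZ]

theorem rotX_add (θ φ : ℝ) : rotX (θ + φ) = rotX θ * rotX φ := by
  apply Subtype.ext
  ext i j
  fin_cases i <;> fin_cases j <;>
    simp [rotX, Real.cos_add, Real.sin_add] <;> ring

theorem rotZ_add (θ φ : ℝ) : rotZ (θ + φ) = rotZ θ * rotZ φ := by
  apply Subtype.ext
  ext i j
  fin_cases i <;> fin_cases j <;>
    simp [rotZ, Real.cos_add, Real.sin_add] <;> ring

theorem rotX_zpow (θ : ℝ) (n : ℤ) : rotX θ ^ n = rotX (θ * n) := by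
  let f : Multiplicative ℝ →* SO3 := ⟨⟨fun x => rotX x.toAdd, rotX_zero⟩, rotX_add⟩
  have := map_zpow f (Multiplicative.ofAdd θ) n
  rw [← ofAdd_zsmul, zsmul_eq_mul, mul_comm] at this
  exact this.symm

theorem rotZ_zpow (θ : ℝ) (n : ℤ) : rotZ θ ^ n = rotZ (θ * n) := by
  let f : Multiplicative ℝ →* SO3 := ⟨⟨fun x => rotZ x.toAdd, rotZ_zero⟩, rotZ_add⟩
  have := map_zpow f (Multiplicative.ofAdd θ) n
  rw [← ofAdd_zsmul, zsmul_eq_mul, mul_comm] at this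
  exact this.symm

theorem rotX_mul_rotZ_of_sin_eq_zero {θ : ℝ} (hs : Real.sin θ = 0) (hc : Real.cos θ = -1)
    (φ : ℝ) : rotX θ * rotZ φ = rotZ (-φ) * rotX θ := by
  apply Subtype.ext
  ext i j
  fin_cases i <;> fin_cases j <;>
    simp [rotX, rotZ, hs, hc]

theorem rotZ_mul_rotX_of_sin_eq_zero {φ : ℝ} (hs : Real.sin φ = 0) (hc : Real.cos φ = -1)
    (θ : ℝ) : rotZ φ * rotX θ = rotX (-θ) * rotZ φ := by
  apply Subtype.ext
  ext i j
  fin_cases i <;> fin_cases j <;>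
    simp [rotX, rotZ, hs, hc]

theorem rotX_mul_apply (θ : ℝ) (g : SO3) :
    (rotX θ * g).1 0 0 = g.1 0 0 ∧
    (rotX θ * g).1 1 0 = Real.cos θ * g.1 1 0 - Real.sin θ * g.1 2 0 ∧
    (rotX θ * g).1 2 0 = Real.sin θ * g.1 1 0 + Real.cos θ * g.1 2 0 := by
  refine ⟨?_, ?_, ?_⟩ <;> simp [rotX, Matrix.mul_apply, Fin.sum_univ_three]
  ring

theorem rotZ_mul_apply (φ : ℝ) (g : SO3) :
    (rotZ φ * g).1 0 0 = Real.cos φ * g.1 0 0 - Real.sin φ * g.1 1 0 ∧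
    (rotZ φ * g).1 1 0 = Real.sin φ * g.1 0 0 + Real.cos φ * g.1 1 0 ∧
    (rotZ φ * g).1 2 0 = g.1 2 0 := by
  refine ⟨?_, ?_, ?_⟩ <;> simp [rotZ, Matrix.mul_apply, Fin.sum_univ_three]
  ring

theorem rotX_mul_rotZ_apply (θ φ : ℝ) :
    (rotX θ * rotZ φ).1 0 0 = Real.cos φ ∧ (rotX θ * rotZ φ).1 2 2 = Real.cos θ ∧
    (rotX θ * rotZ φ).1 1 0 = Real.cos θ * Real.sin φ ∧
    (rotX θ * rotZ φ).1 2 0 = Real.sin θ * Real.sin φ := by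
  refine ⟨?_, ?_, ?_, ?_⟩ <;> simp [rotX, rotZ]

theorem column_sq_sum (g : SO3) : g.1 0 0 ^ 2 + g.1 1 0 ^ 2 + g.1 2 0 ^ 2 = 1 := by
  have h := (Matrix.mem_orthogonalGroup_iff' (Fin 3) ℝ).mp (Matrix.mem_specialOrthogonalGroup_iff.mp g.2).1
  have h0 := congrFun (congrFun h 0) 0
  simp [Matrix.mul_apply, Fin.sum_univ_three] at h0
  linarith

theorem dvd_of_cos_eq_one {n : ℕ} (hn : n ≠ 0) {a : ℤ} (h : Real.cos (2 * Real.pi / n * a) = 1) :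
    (n : ℤ) ∣ a := by
  obtain ⟨k, hk⟩ := (Real.cos_eq_one_iff _).mp h
  refine ⟨k, ?_⟩
  have hn' : (n : ℝ) ≠ 0 := by exact_mod_cast hn
  have hpi := Real.pi_ne_zero
  field_simp at hk
  rw [mul_comm]
  exact_mod_cast hk.symm

/-! ### Valuations of the first column under rotations. -/

section
variable {Γ₀ : Type*} [LinearOrderedCommGroupWithZero Γ₀] (v : Valuation ℝ Γ₀)

/-- Distinct valuations could not cancel, and the sum of squares would have valuation above 1. -/
theorem valuation_eq_of_sq_add_sq_eq_one {c s : ℝ} (h : c ^ 2 + s ^ 2 = 1) (hc : 1 < v c) :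
    v c = v s := by
  by_contra hne
  have hne' : v (c ^ 2) ≠ v (s ^ 2) := by
    rw [map_pow, map_pow]
    exact fun e => hne ((pow_left_inj₀ zero_le zero_le two_ne_zero).mp e)
  have := v.map_add_of_distinct_val hne'
  rw [h, map_one, map_pow, map_pow] at this
  exact ((one_lt_pow₀ hc two_ne_zero).trans_le (le_max_left _ _)).ne this

/-- The elements whose first column is `±e₁`. -/
def axisSet : Set SO3 := {g | g.1 1 0 = 0 ∧ g.1 2 0 = 0}

/-- The elements of whose first column the first two entries have different valuations and the
third entry is not dominant. -/
def unequalSet : Set SO3 :=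
  {g | v (g.1 0 0) ≠ v (g.1 1 0) ∧ v (g.1 2 0) ≤ max (v (g.1 0 0)) (v (g.1 1 0))}

/-- The elements of whose first column the first two entries have the same valuation, larger than
that of the third entry. -/
def equalSet : Set SO3 := {g | v (g.1 0 0) = v (g.1 1 0) ∧ v (g.1 2 0) < v (g.1 0 0)}

theorem axisSet_subset_unequalSet : axisSet ⊆ unequalSet v := by
  rintro g ⟨h1, h2⟩
  have h := column_sq_sum g
  rw [h1, h2] at h
  have h0 : g.1 0 0 ≠ 0 := by
    intro h0
    rw [h0] at h
    norm_num at h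
  refine ⟨?_, ?_⟩
  · rw [h1, map_zero]
    exact v.ne_zero_iff.mpr h0
  · rw [h2, map_zero]
    exact zero_le

/-- Sine and cosine have equal valuation, so the unequal first two entries cannot cancel: both new
ones have valuation v(cos φ) times the old maximum, above that of the unchanged third entry. -/
theorem rotZ_mul_mem_equalSet {φ : ℝ} (hc : 1 < v (Real.cos φ)) {g : SO3}
    (hg : g ∈ unequalSet v) : rotZ φ * g ∈ equalSet v := by
  obtain ⟨hne, hle⟩ := hg
  obtain ⟨e0, e1, e2⟩ := rotZ_mul_apply φ g
  have hcs := valuation_eq_of_sq_add_sq_eq_one v (Real.cos_sq_add_sin_sq φ) hc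
  have hc0 : v (Real.cos φ) ≠ 0 := (zero_lt_one.trans hc).ne'
  have h0 : v ((rotZ φ * g).1 0 0) = v (Real.cos φ) * max (v (g.1 0 0)) (v (g.1 1 0)) := by
    have hd : v (Real.cos φ * g.1 0 0) ≠ v (-(Real.sin φ * g.1 1 0)) := by
      rw [Valuation.map_neg, map_mul, map_mul, ← hcs]
      exact fun h => hne (mul_left_cancel₀ hc0 h)
    rw [e0, sub_eq_add_neg, v.map_add_of_distinct_val hd, Valuation.map_neg, map_mul, map_mul,
      ← hcs, mul_max]
  have h1 : v ((rotZ φ * g).1 1 0) = v (Real.cos φ) * max (v (g.1 0 0)) (v (g.1 1 0)) := by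
    have hd : v (Real.sin φ * g.1 0 0) ≠ v (Real.cos φ * g.1 1 0) := by
      rw [map_mul, map_mul, ← hcs]
      exact fun h => hne (mul_left_cancel₀ hc0 h)
    rw [e1, v.map_add_of_distinct_val hd, map_mul, map_mul, ← hcs, mul_max]
  refine ⟨h0.trans h1.symm, ?_⟩
  rw [h0, e2]
  refine hle.trans_lt (lt_mul_of_one_lt_left ?_ hc)
  rcases hne.lt_or_gt with h | h
  · exact lt_max_of_lt_right (zero_le.trans_lt h)
  · exact lt_max_of_lt_left (zero_le.trans_lt h)

/-- If v(cos θ) > 1, the second entry dominates and both lower entries outgrow the fixed first one.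
A quarter-turn swaps the lower entries up to sign; the third then ties with the first, whence the
weak inequality in `unequalSet`. -/
theorem rotX_mul_mem_unequalSet {θ : ℝ} (hc : 1 < v (Real.cos θ) ∨ Real.cos θ = 0) {g : SO3}
    (hg : g ∈ equalSet v) : rotX θ * g ∈ unequalSet v ∧ rotX θ * g ∉ axisSet := by
  obtain ⟨he, hlt⟩ := hg
  obtain ⟨e0, e1, e2⟩ := rotX_mul_apply θ g
  have hpos : 0 < v (g.1 0 0) := zero_le.trans_lt hlt
  have hcs := Real.cos_sq_add_sin_sq θ
  rcases hc with hc | hc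
  · have hvcs := valuation_eq_of_sq_add_sq_eq_one v hcs hc
    have hc0 : 0 < v (Real.cos θ) := zero_lt_one.trans hc
    have hlt' : v (g.1 2 0) < v (g.1 1 0) := he ▸ hlt
    have h1 : v ((rotX θ * g).1 1 0) = v (Real.cos θ) * v (g.1 0 0) := by
      rw [e1, v.map_sub_eq_of_lt_left, map_mul, he]
      rw [map_mul, map_mul, ← hvcs]
      exact mul_lt_mul_of_pos_left hlt' hc0
    have h2 : v ((rotX θ * g).1 2 0) = v (Real.cos θ) * v (g.1 0 0) := by
      rw [e2, v.map_add_eq_of_lt_left, map_mul, he, ← hvcs]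
      rw [map_mul, map_mul, ← hvcs]
      exact mul_lt_mul_of_pos_left hlt' hc0
    have hgt : v (g.1 0 0) < v (Real.cos θ) * v (g.1 0 0) := lt_mul_of_one_lt_left hpos hc
    refine ⟨⟨?_, ?_⟩, fun h => ?_⟩
    · rw [h1, e0]
      exact hgt.ne
    · rw [h1, h2]
      exact le_max_right _ _
    · rw [h.1, map_zero] at h1
      exact (mul_pos hc0 hpos).ne h1
  · have hs1 : v (Real.sin θ) = 1 :=
      valuation_eq_one_of_pow_eq_one v two_ne_zero (by rw [hc] at hcs; linarith)
    rw [hc, zero_mul, zero_sub] at e1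
    rw [hc, zero_mul, add_zero] at e2
    have h1 : v ((rotX θ * g).1 1 0) = v (g.1 2 0) := by
      rw [e1, Valuation.map_neg, map_mul, hs1, one_mul]
    have h2 : v ((rotX θ * g).1 2 0) = v (g.1 0 0) := by
      rw [e2, map_mul, hs1, one_mul, he]
    refine ⟨⟨?_, ?_⟩, fun h => ?_⟩
    · rw [h1, e0]
      exact hlt.ne'
    · rw [e0, h2]
      exact le_max_left _ _
    · rw [h.2, map_zero] at h2
      exact hpos.ne h2

end

/-! ### Ping-pong for the generators of G(p,q). -/

theorem genA_zpow (p : ℕ) (a : ℤ) : genA p ^ a = rotX (2 * Real.pi / p * a) := rotX_zpow _ _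

theorem genB_zpow (q : ℕ) (b : ℤ) : genB q ^ b = rotZ (2 * Real.pi / q * b) := rotZ_zpow _ _

theorem angle_mul_eq {n : ℕ} (hn : n ≠ 0) {a m : ℤ} (h : 2 * a = n * m) :
    2 * Real.pi / n * a = m * Real.pi := by
  have hn' : (n : ℝ) ≠ 0 := by exact_mod_cast hn
  have h' : (2 * a : ℝ) = n * m := by exact_mod_cast h
  field_simp
  linear_combination h'

/-- The generators of `G(p, q)` satisfy the ping-pong conditions. -/
theorem nonempty_pingPong {P Q q : ℕ} (hP : 0 < P) (hQ : Odd Q) (hq : q = Q ∨ q = 2 * Q) :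
    Nonempty (PingPong (genA (2 * P)) (genB q) P Q q) := by
  obtain ⟨Γ₀, _, v', hv'⟩ := exists_valuation_two_lt_one
  let v : Valuation ℝ Γ₀ := v'.comap Complex.ofRealHom
  have hQ0 : 0 < Q := hQ.pos
  have hp0 : 2 * P ≠ 0 := by omega
  have hq0 : q ≠ 0 := by omega
  have hQq : ∃ c : ℤ, 2 * (Q : ℤ) = q * c := by
    rcases hq with rfl | rfl
    · exact ⟨2, by ring⟩
    · exact ⟨1, by push_cast; ring⟩
  obtain ⟨c, hc⟩ := hQq
  refine ⟨{
    P_pos := by exact_mod_cast hP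
    Q_pos := by exact_mod_cast hQ0
    Q_odd := by exact_mod_cast hQ
    q_eq := by exact_mod_cast hq
    zpow_A := ?_
    zpow_B := ?_
    dvd_of_mul_eq_one := ?_
    zpow_P_mul := ?_
    zpow_Q_mul := ?_
    E := axisSet
    U := unequalSet v
    V := equalSet v
    zpow_mul_zpow_mem_E := ?_
    zpow_A_mul_mem_E := ?_
    E_subset_U := axisSet_subset_unequalSet v
    notMem_V_of_mem_U := fun g hU hV => hU.1 hV.1
    zpow_B_mul_mem_V := ?_
    zpow_A_mul_mem_U := ?_ }⟩
  · rw [genA_zpow, angle_mul_eq hp0 (m := 2) (by push_cast; ring), ← rotX_zero]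
    apply Subtype.ext
    simp [rotX]
  · rw [genB_zpow, angle_mul_eq hq0 (m := 2) (by ring), ← rotZ_zero]
    apply Subtype.ext
    simp [rotZ]
  · intro a b h
    rw [genA_zpow, genB_zpow] at h
    obtain ⟨h0, h2, -⟩ := rotX_mul_rotZ_apply (2 * Real.pi / (2 * P : ℕ) * a)
      (2 * Real.pi / q * b)
    rw [h] at h0 h2
    have ha := dvd_of_cos_eq_one hp0 (a := a) (h2.symm.trans (by simp))
    have hb := dvd_of_cos_eq_one hq0 (a := b) (h0.symm.trans (by simp))
    exact ⟨by exact_mod_cast ha, hb⟩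
  · intro b
    rw [genA_zpow, genB_zpow, genB_zpow, angle_mul_eq hp0 (m := 1) (by push_cast; ring),
      rotX_mul_rotZ_of_sin_eq_zero (by simp) (by simp)]
    simp
  · rcases hq with rfl | rfl
    · refine ⟨1, .inl rfl, fun a => ?_⟩
      have : genB q ^ (q : ℤ) = 1 := by
        rw [genB_zpow, angle_mul_eq hq0 (m := 2) (by ring), ← rotZ_zero]
        apply Subtype.ext
        simp [rotZ]
      simp [this]
    · refine ⟨-1, .inr rfl, fun a => ?_⟩
      rw [genA_zpow, genB_zpow, genA_zpow, angle_mul_eq hq0 (m := 1) (by push_cast; ring),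
        rotZ_mul_rotX_of_sin_eq_zero (by simp) (by simp)]
      simp
  · intro m n
    rw [genA_zpow, genB_zpow, angle_mul_eq hq0 (m := c * n) (by rw [← mul_assoc, hc]; ring)]
    obtain ⟨-, -, h1, h2⟩ := rotX_mul_rotZ_apply (2 * Real.pi / (2 * P : ℕ) * (P * m : ℤ))
      ((c * n : ℤ) * Real.pi)
    rw [Real.sin_int_mul_pi, mul_zero] at h1 h2
    exact ⟨h1, h2⟩
  · rintro a g ⟨h1, h2⟩
    rw [genA_zpow]
    obtain ⟨-, e1, e2⟩ := rotX_mul_apply (2 * Real.pi / (2 * P : ℕ) * a) g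
    exact ⟨by rw [e1, h1, h2]; simp, by rw [e2, h1, h2]; simp⟩
  · intro b g hb hg
    rw [genB_zpow]
    refine rotZ_mul_mem_equalSet v (one_lt_valuation_cos v' hv' hq0 ?_) hg
    intro hd
    have h4 : (Q : ℤ) ∣ 2 * (2 * b) := by
      rw [← mul_assoc]
      refine dvd_trans ?_ hd
      rcases hq with rfl | rfl
      · exact dvd_rfl
      · exact ⟨2, by push_cast; ring⟩
    have hcop : IsCoprime (Q : ℤ) 2 := by
      exact_mod_cast Nat.isCoprime_iff_coprime.mpr (Nat.coprime_two_right.mpr hQ)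
    exact hb (hcop.dvd_of_dvd_mul_left (hcop.dvd_of_dvd_mul_left h4))
  · intro a g ha hg
    rw [genA_zpow]
    refine rotX_mul_mem_unequalSet v ?_ hg
    -- If 2P divides 4a but P does not divide a, then 2a is an odd multiple of P and the angle an
    -- odd multiple of π/2.
    by_cases hd : ((2 * P : ℕ) : ℤ) ∣ 4 * a
    · right
      obtain ⟨m, hm⟩ := hd
      push_cast at hm
      have hm' : 2 * a = P * m := by linarith
      rw [Real.cos_eq_zero_iff]
      rcases Int.even_or_odd' m with ⟨k, rfl | rfl⟩
      · exact absurd ⟨k, by linarith⟩ ha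
      · refine ⟨k, ?_⟩
        have h' : (2 * a : ℝ) = P * (2 * k + 1) := by exact_mod_cast hm'
        have hP' : (P : ℝ) ≠ 0 := by exact_mod_cast hP.ne'
        push_cast
        field_simp
        linear_combination h'
    · exact .inl (one_lt_valuation_cos v' hv' hp0 hd)

/-! ### Words described by their end syllables. -/

/-- The words that consist of a single pair satisfying `S`, or of a first pair satisfying `F`,
pairs satisfying `M` and a last pair satisfying `L`. -/
def IsForm (S F M L : ℤ × ℤ → Prop) (w : List (ℤ × ℤ)) : Prop :=
  (∃ x, w = [x] ∧ S x) ∨ ∃ x m y, w = x :: (m ++ [y]) ∧ F x ∧ (∀ z ∈ m, M z) ∧ L y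

theorem isForm_iff {S F M L : ℤ × ℤ → Prop} {w : List (ℤ × ℤ)} :
    IsForm S F M L w ↔ 0 < w.length ∧ ∀ (i : ℕ) (hi : i < w.length),
      (w.length = 1 → S w[i]) ∧ (i = 0 → 1 < w.length → F w[i]) ∧
      (0 < i → i + 1 < w.length → M w[i]) ∧ (0 < i → i + 1 = w.length → L w[i]) := by
  constructor
  · rintro (⟨x, rfl, h⟩ | ⟨x, m, y, rfl, hx, hm, hy⟩)
    · refine ⟨by simp, fun i hi => ?_⟩
      simp only [List.length_singleton, Nat.lt_one_iff] at hi
      subst hi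
      simp [h]
    · refine ⟨by simp, fun i hi => ⟨by simp, ?_, ?_, ?_⟩⟩
      · rintro rfl -
        exact hx
      · intro h0 h1
        obtain ⟨j, rfl⟩ := Nat.exists_eq_succ_of_ne_zero h0.ne'
        have hj : j < m.length := by simpa using h1
        simpa [List.getElem_append_left hj] using hm _ (List.getElem_mem hj)
      · intro h0 h1
        obtain ⟨j, rfl⟩ := Nat.exists_eq_succ_of_ne_zero h0.ne'
        have hj : j = m.length := by simpa using h1
        subst hj
        simpa using hy
  · rintro ⟨h0, h⟩
    match w, h0, h with
    | [x], _, h => exact .inl ⟨x, rfl, (h 0 (by simp)).1 rfl⟩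
    | x :: x' :: t, _, h =>
      obtain ⟨m, y, e⟩ := (List.eq_nil_or_concat (x' :: t)).resolve_left (by simp)
      simp only [e, List.concat_eq_append] at h ⊢
      refine .inr ⟨x, m, y, rfl, (h 0 (by simp)).2.1 rfl (by simp), fun z hz => ?_, ?_⟩
      · obtain ⟨j, hj, rfl⟩ := List.getElem_of_mem hz
        have := (h (j + 1) (by simp; omega)).2.2.1 (by omega) (by simpa using hj)
        simpa [List.getElem_append_left hj] using this
      · have := (h (m.length + 1) (by simp)).2.2.2 (by omega) (by simp)
        simpa using this

/-- A pair of nontrivial representatives. -/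
def IsMid (P Q : ℤ) (x : ℤ × ℤ) : Prop := IsRepA P x.1 ∧ x.1 ≠ 0 ∧ IsRepB Q x.2 ∧ x.2 ≠ 0

theorem isTail_append_singleton {P Q : ℤ} {m : List (ℤ × ℤ)} {y : ℤ × ℤ} :
    IsTail P Q (m ++ [y]) ↔
      (∀ z ∈ m, IsMid P Q z) ∧ IsRepA P y.1 ∧ y.1 ≠ 0 ∧ IsRepB Q y.2 := by
  induction m with
  | nil =>
    constructor
    · rintro (_ | ⟨ha, ha0, hb, hb0, hr⟩)
      exact ⟨by simp, ha, ha0, hb⟩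
    · rintro ⟨-, ha, ha0, hb⟩
      exact .cons ha ha0 hb (.inr rfl) .nil
  | cons x m ih =>
    constructor
    · rintro (_ | ⟨ha, ha0, hb, hb0, hr⟩)
      obtain ⟨h, h'⟩ := ih.mp hr
      refine ⟨?_, h'⟩
      rw [List.forall_mem_cons]
      exact ⟨⟨ha, ha0, hb, hb0.resolve_right (by simp)⟩, h⟩
    · rintro ⟨h, h'⟩
      rw [List.forall_mem_cons] at h
      exact .cons h.1.1 h.1.2.1 h.1.2.2.1 (.inl h.1.2.2.2) (ih.mpr ⟨h.2, h'⟩)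

theorem isNormal_iff_isForm {P Q : ℤ} {w : List (ℤ × ℤ)} :
    IsNormal P Q w ↔ IsForm (fun x => IsRepA P x.1 ∧ IsRepB Q x.2)
      (fun x => IsRepA P x.1 ∧ IsRepB Q x.2 ∧ x.2 ≠ 0) (IsMid P Q)
      (fun x => IsRepA P x.1 ∧ x.1 ≠ 0 ∧ IsRepB Q x.2) w := by
  constructor
  · rintro ⟨ha, hb, hb0, hr⟩
    rename_i a b r
    rcases List.eq_nil_or_concat r with rfl | ⟨m, y, rfl⟩
    · exact .inl ⟨_, rfl, ha, hb⟩
    · rw [List.concat_eq_append] at hr ⊢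
      obtain ⟨h, h'⟩ := isTail_append_singleton.mp hr
      exact .inr ⟨_, m, y, rfl, ⟨ha, hb, by simpa using hb0⟩, h, h'⟩
  · rintro (⟨x, rfl, ha, hb⟩ | ⟨x, m, y, rfl, ⟨ha, hb, hb0⟩, h, h'⟩)
    · exact .cons ha hb (.inr rfl) .nil
    · exact .cons ha hb (.inl hb0) (isTail_append_singleton.mpr ⟨h, h'⟩)

/-! ### Absorbing core factors into end syllables. -/

namespace PingPong
variable {Γ : Type*} [Group Γ] {A B : Γ} {P Q q : ℤ} (D : PingPong A B P Q q)
include D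

theorem q_pos : 0 < q := by
  have := D.Q_pos
  rcases D.q_eq with h | h <;> omega

theorem Q_dvd_q : Q ∣ q := by
  rcases D.q_eq with h | h
  · exact ⟨1, by omega⟩
  · exact ⟨2, by omega⟩

theorem pair_injective {x y : ℤ × ℤ} (hx : IsRepA (2 * P) x.1 ∧ IsRepA q x.2)
    (hy : IsRepA (2 * P) y.1 ∧ IsRepA q y.2) (h : A ^ x.1 * B ^ x.2 = A ^ y.1 * B ^ y.2) :
    x = y := by
  have h' : A ^ (x.1 - y.1) * B ^ (x.2 - y.2) = 1 := by
    rw [sub_eq_neg_add, zpow_add, zpow_sub, mul_assoc, ← mul_assoc (A ^ x.1), h]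
    simp [zpow_neg, mul_assoc]
  obtain ⟨ha, hb⟩ := D.dvd_of_mul_eq_one _ _ h'
  exact Prod.ext (hx.1.eq_of_dvd hy.1 ha) (hx.2.eq_of_dvd hy.2 hb)

theorem exists_zpow_A_eq (a : ℤ) : ∃ a', IsRepA (2 * P) a' ∧ A ^ a' = A ^ a ∧ P ∣ a - a' := by
  obtain ⟨a', m, h, rfl⟩ := exists_isRepA (mul_pos two_pos D.P_pos) a
  refine ⟨a', h, ?_, 2 * m, by ring⟩
  rw [zpow_add, zpow_mul, D.zpow_A, one_zpow, mul_one]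

theorem exists_zpow_B_eq (b : ℤ) : ∃ b', IsRepA q b' ∧ B ^ b' = B ^ b ∧ Q ∣ b - b' := by
  obtain ⟨b', m, h, rfl⟩ := exists_isRepA D.q_pos b
  refine ⟨b', h, ?_, ?_⟩
  · rw [zpow_add, zpow_mul, D.zpow_B, one_zpow, mul_one]
  · rw [add_sub_cancel_left]
    exact D.Q_dvd_q.mul_right m

/-- The core only shifts b by a multiple of Q, so a B-exponent nonzero mod Q stays so; exponents are
then reduced modulo the full orders. -/
theorem exists_pair_eq_core_mul {k : Γ} (hk : k ∈ D.core) (a b : ℤ) : ∃ a' b',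
    IsRepA (2 * P) a' ∧ IsRepA q b' ∧ (Q ∣ b' → Q ∣ b) ∧
      A ^ a' * B ^ b' = k * (A ^ a * B ^ b) := by
  obtain ⟨m, n, rfl⟩ := hk
  obtain ⟨s, -, h⟩ := D.exists_sign_of_zpow_B n
  obtain ⟨a', ha', ea, -⟩ := D.exists_zpow_A_eq (P * m + s * a)
  obtain ⟨b', hb', eb, hd⟩ := D.exists_zpow_B_eq (Q * n + b)
  refine ⟨a', b', ha', hb', fun h' => ?_, ?_⟩
  · have := (dvd_sub_left h').mp hd
    exact (dvd_add_right (Dvd.intro n rfl)).mp this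
  · rw [ea, eb, zpow_add, zpow_add, mul_assoc, ← mul_assoc (A ^ (s * a)), ← h]
    simp only [mul_assoc]

theorem exists_core_mul_eq_pair (a b : ℤ) : ∃ k ∈ D.core, ∃ a' b', IsRepA P a' ∧ IsRepB Q b' ∧
    (b' = 0 → Q ∣ b) ∧ A ^ a * B ^ b = k * (A ^ a' * B ^ b') := by
  obtain ⟨b', n, hb', rfl⟩ := exists_isRepB D.Q_pos D.Q_odd b
  obtain ⟨s, hs, h⟩ := D.exists_sign_of_zpow_B n
  obtain ⟨a', m, ha', e⟩ := exists_isRepA D.P_pos (s * a)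
  refine ⟨B ^ (Q * n) * A ^ (P * m), mul_mem (D.zpow_B_mem_core n) (D.zpow_A_mem_core m), a', b',
    ha', hb', fun h0 => by simp [h0], ?_⟩
  have h1 : A ^ a * B ^ (Q * n) = B ^ (Q * n) * A ^ (P * m + a') := by
    rw [add_comm, ← e, h, ← mul_assoc, sign_mul_self hs, one_mul]
  rw [add_comm, zpow_add, ← mul_assoc, h1, zpow_add]
  simp only [mul_assoc]

theorem exists_pair_eq_mul_core {k : Γ} (hk : k ∈ D.core) (a b : ℤ) : ∃ a' b',
    IsRepA (2 * P) a' ∧ IsRepA q b' ∧ (P ∣ a' → P ∣ a) ∧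
      A ^ a' * B ^ b' = A ^ a * B ^ b * k := by
  obtain ⟨m, n, rfl⟩ := hk
  obtain ⟨t, ht, h⟩ := D.exists_sign_of_zpow_A m
  obtain ⟨a', ha', ea, hd⟩ := D.exists_zpow_A_eq (a + P * m)
  obtain ⟨b', hb', eb, -⟩ := D.exists_zpow_B_eq (t * b + Q * n)
  refine ⟨a', b', ha', hb', fun h' => ?_, ?_⟩
  · have := (dvd_sub_left h').mp hd
    exact (dvd_add_left (Dvd.intro m rfl)).mp this
  · rw [ea, eb, zpow_add, zpow_add, mul_assoc, ← mul_assoc (A ^ (P * m)), h, ← mul_assoc t,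
      sign_mul_self ht, one_mul]
    simp only [mul_assoc]

theorem exists_mul_core_eq_pair (a b : ℤ) : ∃ k ∈ D.core, ∃ a' b', IsRepA P a' ∧ IsRepB Q b' ∧
    (a' = 0 → P ∣ a) ∧ A ^ a * B ^ b = A ^ a' * B ^ b' * k := by
  obtain ⟨a', m, ha', rfl⟩ := exists_isRepA D.P_pos a
  obtain ⟨t, ht, h⟩ := D.exists_sign_of_zpow_A m
  obtain ⟨b', n, hb', e⟩ := exists_isRepB D.Q_pos D.Q_odd (t * b)
  refine ⟨B ^ (Q * n) * A ^ (P * m), mul_mem (D.zpow_B_mem_core n) (D.zpow_A_mem_core m), a', b',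
    ha', hb', fun h0 => by simp [h0], ?_⟩
  rw [zpow_add, mul_assoc, h, e, zpow_add]
  simp only [mul_assoc]

/-- Existence and uniqueness of a canonical form, given a decomposition of the elements of the
group into two multipliers and a normal word. -/
theorem existsUnique_isForm {S F L : ℤ × ℤ → Prop} (K : Set (Γ × Γ)) {g : Γ}
    (hS : ∀ x, S x → IsRepA (2 * P) x.1 ∧ IsRepA q x.2)
    (hF : ∀ x, F x → IsRepA (2 * P) x.1 ∧ IsRepA q x.2)
    (hL : ∀ x, L x → IsRepA (2 * P) x.1 ∧ IsRepA q x.2)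
    (hg : ∃ w, IsNormal P Q w ∧ ∃ k ∈ K, g = k.1 * evalWord A B w * k.2)
    (huniq : ∀ w w', IsNormal P Q w → IsNormal P Q w' → ∀ k ∈ K, ∀ k' ∈ K,
      k.1 * evalWord A B w * k.2 = k'.1 * evalWord A B w' * k'.2 → w = w' ∧ k = k')
    (S_of : ∀ k ∈ K, ∀ y : ℤ × ℤ, IsRepA P y.1 ∧ IsRepB Q y.2 →
      ∃ x, S x ∧ A ^ x.1 * B ^ x.2 = k.1 * (A ^ y.1 * B ^ y.2) * k.2)
    (S_to : ∀ x, S x → ∃ k ∈ K, ∃ y : ℤ × ℤ, (IsRepA P y.1 ∧ IsRepB Q y.2) ∧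
      A ^ x.1 * B ^ x.2 = k.1 * (A ^ y.1 * B ^ y.2) * k.2)
    (FL_of : ∀ k ∈ K, ∀ y y' : ℤ × ℤ, IsRepA P y.1 ∧ IsRepB Q y.2 ∧ y.2 ≠ 0 →
      IsRepA P y'.1 ∧ y'.1 ≠ 0 ∧ IsRepB Q y'.2 → ∃ x x', F x ∧ L x' ∧
        A ^ x.1 * B ^ x.2 = k.1 * (A ^ y.1 * B ^ y.2) ∧
        A ^ x'.1 * B ^ x'.2 = A ^ y'.1 * B ^ y'.2 * k.2)
    (FL_to : ∀ x x', F x → L x' → ∃ k ∈ K, ∃ y y' : ℤ × ℤ,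
      (IsRepA P y.1 ∧ IsRepB Q y.2 ∧ y.2 ≠ 0) ∧ (IsRepA P y'.1 ∧ y'.1 ≠ 0 ∧ IsRepB Q y'.2) ∧
        A ^ x.1 * B ^ x.2 = k.1 * (A ^ y.1 * B ^ y.2) ∧
        A ^ x'.1 * B ^ x'.2 = A ^ y'.1 * B ^ y'.2 * k.2) :
    ∃! w, IsForm S F (IsMid P Q) L w ∧ evalWord A B w = g := by
  obtain ⟨t, ht, k, hk, rfl⟩ := hg
  have hsingle : ∀ (k : Γ × Γ) (x y : ℤ × ℤ),
      A ^ x.1 * B ^ x.2 = k.1 * (A ^ y.1 * B ^ y.2) * k.2 →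
      evalWord A B [x] = k.1 * evalWord A B [y] * k.2 := by
    intro k x y h
    simpa using h
  have hlong : ∀ (k : Γ × Γ) (x y x' y' : ℤ × ℤ) (m : List (ℤ × ℤ)),
      A ^ x.1 * B ^ x.2 = k.1 * (A ^ y.1 * B ^ y.2) →
      A ^ x'.1 * B ^ x'.2 = A ^ y'.1 * B ^ y'.2 * k.2 →
      evalWord A B (x :: (m ++ [x'])) = k.1 * evalWord A B (y :: (m ++ [y'])) * k.2 := by
    intro k x y x' y' m h h'
    simp only [evalWord_cons, evalWord_append, evalWord_nil, mul_one, h']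
    rw [← mul_assoc, h]
    simp only [mul_assoc]
  have hex : ∃ w, IsForm S F (IsMid P Q) L w ∧
      evalWord A B w = k.1 * evalWord A B t * k.2 := by
    rcases isNormal_iff_isForm.mp ht with ⟨y, rfl, hy⟩ | ⟨y, m, y', rfl, hy, hm, hy'⟩
    · obtain ⟨x, hx, e⟩ := S_of k hk y hy
      exact ⟨[x], .inl ⟨x, rfl, hx⟩, hsingle k x y e⟩
    · obtain ⟨x, x', hx, hx', e, e'⟩ := FL_of k hk y y' hy hy'
      exact ⟨_, .inr ⟨x, m, x', rfl, hx, hm, hx'⟩, hlong k x y x' y' m e e'⟩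
  -- By `huniq`, any form with this value comes from the same t and k. So two such forms share their
  -- middle, and their end syllables have equal values, hence equal exponents by `pair_injective`.
  have hto : ∀ w, IsForm S F (IsMid P Q) L w → evalWord A B w = k.1 * evalWord A B t * k.2 →
      (∃ x y, w = [x] ∧ t = [y] ∧ S x ∧
        A ^ x.1 * B ^ x.2 = k.1 * (A ^ y.1 * B ^ y.2) * k.2) ∨
      ∃ x y m x' y', w = x :: (m ++ [x']) ∧ t = y :: (m ++ [y']) ∧ F x ∧ L x' ∧
        A ^ x.1 * B ^ x.2 = k.1 * (A ^ y.1 * B ^ y.2) ∧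
        A ^ x'.1 * B ^ x'.2 = A ^ y'.1 * B ^ y'.2 * k.2 := by
    rintro w (⟨x, rfl, hx⟩ | ⟨x, m, x', rfl, hx, hm, hx'⟩) h
    · obtain ⟨k', hk', y, hy, e⟩ := S_to x hx
      obtain ⟨rfl, rfl⟩ := huniq _ _ (isNormal_iff_isForm.mpr (.inl ⟨y, rfl, hy⟩)) ht k' hk' k hk
        ((hsingle k' x y e).symm.trans h)
      exact .inl ⟨x, y, rfl, rfl, hx, e⟩
    · obtain ⟨k', hk', y, y', hy, hy', e, e'⟩ := FL_to x x' hx hx'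
      obtain ⟨rfl, rfl⟩ := huniq _ _
        (isNormal_iff_isForm.mpr (.inr ⟨y, m, y', rfl, hy, hm, hy'⟩)) ht k' hk' k hk
        ((hlong k' x y x' y' m e e').symm.trans h)
      exact .inr ⟨x, y, m, x', y', rfl, rfl, hx, hx', e, e'⟩
  obtain ⟨w, hw, ew⟩ := hex
  refine ⟨w, ⟨hw, ew⟩, ?_⟩
  rintro w' ⟨hw', ew'⟩
  rcases hto w hw ew with ⟨x, y, rfl, rfl, hx, e⟩ | ⟨x, y, m, x', y', rfl, rfl, hx, hx', e, e'⟩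
  · rcases hto w' hw' ew' with ⟨x₁, y₁, rfl, hy, hx₁, e₁⟩ | ⟨x₁, y₁, m₁, x₁', y₁', rfl, hy, -⟩
    · obtain rfl : y = y₁ := by simpa using hy
      rw [D.pair_injective (hS _ hx₁) (hS _ hx) (e₁.trans e.symm)]
    · simp at hy
  · rcases hto w' hw' ew' with
      ⟨x₁, y₁, rfl, hy, -⟩ | ⟨x₁, y₁, m₁, x₁', y₁', rfl, hy, hx₁, hx₁', e₁, e₁'⟩
    · simp at hy
    · rw [List.cons.injEq, ← List.concat_eq_append, ← List.concat_eq_append] at hy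
      obtain ⟨rfl, hy⟩ := hy
      obtain rfl := List.init_eq_of_concat_eq hy
      obtain rfl := List.last_eq_of_concat_eq hy
      rw [D.pair_injective (hF _ hx₁) (hF _ hx) (e₁.trans e.symm),
        D.pair_injective (hL _ hx₁') (hL _ hx') (e₁'.trans e'.symm)]

theorem isRepA_two_mul {a : ℤ} (h : IsRepA P a) : IsRepA (2 * P) a := by
  have := D.P_pos
  exact ⟨by linarith [h.1], by linarith [h.2]⟩

theorem isRepA_of_isRepB {b : ℤ} (h : IsRepB Q b) : IsRepA q b := by
  have := D.Q_pos
  have h1 := h.1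
  have h2 := h.2
  rcases D.q_eq with h | h <;> exact ⟨by omega, by omega⟩

theorem existsUnique_left_form {g : Γ} (hg : g ∈ Subgroup.closure {A, B}) :
    ∃! w, IsForm (fun x => IsRepA (2 * P) x.1 ∧ IsRepA q x.2)
      (fun x => IsRepA (2 * P) x.1 ∧ IsRepA q x.2 ∧ ¬ Q ∣ x.2) (IsMid P Q)
      (fun x => IsRepA P x.1 ∧ x.1 ≠ 0 ∧ IsRepB Q x.2) w ∧ evalWord A B w = g := by
  refine D.existsUnique_isForm {k | k.1 ∈ D.core ∧ k.2 = 1} (fun x h => h)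
    (fun x h => ⟨h.1, h.2.1⟩) (fun x h => ⟨D.isRepA_two_mul h.1, D.isRepA_of_isRepB h.2.2⟩)
    ?_ ?_ ?_ ?_ ?_ ?_
  · obtain ⟨w, hw, k, hk, rfl⟩ := D.exists_left_normal hg
    exact ⟨w, hw, (k, 1), ⟨hk, rfl⟩, (mul_one _).symm⟩
  · rintro w w' hw hw' ⟨k, _⟩ ⟨hk, rfl⟩ ⟨k', _⟩ ⟨hk', rfl⟩ h
    obtain ⟨rfl, rfl⟩ := D.left_normal_unique hw hw' hk hk' (by simpa using h)
    exact ⟨rfl, rfl⟩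
  · rintro ⟨k, _⟩ ⟨hk, rfl⟩ y -
    obtain ⟨a, b, ha, hb, -, e⟩ := D.exists_pair_eq_core_mul hk y.1 y.2
    exact ⟨(a, b), ⟨ha, hb⟩, by simpa using e⟩
  · rintro x -
    obtain ⟨k, hk, a, b, ha, hb, -, e⟩ := D.exists_core_mul_eq_pair x.1 x.2
    exact ⟨(k, 1), ⟨hk, rfl⟩, (a, b), ⟨ha, hb⟩, by simpa using e⟩
  · rintro ⟨k, _⟩ ⟨hk, rfl⟩ y y' hy hy'
    obtain ⟨a, b, ha, hb, hd, e⟩ := D.exists_pair_eq_core_mul hk y.1 y.2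
    exact ⟨(a, b), y', ⟨ha, hb, fun h => hy.2.1.not_dvd D.Q_pos hy.2.2 (hd h)⟩, hy', e, by simp⟩
  · rintro x x' hx hx'
    obtain ⟨k, hk, a, b, ha, hb, hd, e⟩ := D.exists_core_mul_eq_pair x.1 x.2
    exact ⟨(k, 1), ⟨hk, rfl⟩, (a, b), x', ⟨ha, hb, fun h => hx.2.2 (hd h)⟩, hx', e, by simp⟩

theorem existsUnique_right_form {g : Γ} (hg : g ∈ Subgroup.closure {A, B}) :
    ∃! w, IsForm (fun x => IsRepA (2 * P) x.1 ∧ IsRepA q x.2)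
      (fun x => IsRepA P x.1 ∧ IsRepB Q x.2 ∧ x.2 ≠ 0) (IsMid P Q)
      (fun x => IsRepA (2 * P) x.1 ∧ IsRepA q x.2 ∧ ¬ P ∣ x.1) w ∧ evalWord A B w = g := by
  refine D.existsUnique_isForm {k | k.1 = 1 ∧ k.2 ∈ D.core} (fun x h => h)
    (fun x h => ⟨D.isRepA_two_mul h.1, D.isRepA_of_isRepB h.2.1⟩) (fun x h => ⟨h.1, h.2.1⟩)
    ?_ ?_ ?_ ?_ ?_ ?_
  · obtain ⟨w, hw, k, hk, rfl⟩ := D.exists_normal hg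
    exact ⟨w, hw, (1, k), ⟨rfl, hk⟩, by simp⟩
  · rintro w w' hw hw' ⟨_, k⟩ ⟨rfl, hk⟩ ⟨_, k'⟩ ⟨rfl, hk'⟩ h
    obtain ⟨rfl, rfl⟩ := D.normal_unique hw hw' hk hk' (by simpa using h)
    exact ⟨rfl, rfl⟩
  · rintro ⟨_, k⟩ ⟨rfl, hk⟩ y -
    obtain ⟨a, b, ha, hb, -, e⟩ := D.exists_pair_eq_mul_core hk y.1 y.2
    exact ⟨(a, b), ⟨ha, hb⟩, by simpa using e⟩
  · rintro x -
    obtain ⟨k, hk, a, b, ha, hb, -, e⟩ := D.exists_mul_core_eq_pair x.1 x.2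
    exact ⟨(1, k), ⟨rfl, hk⟩, (a, b), ⟨ha, hb⟩, by simpa using e⟩
  · rintro ⟨_, k⟩ ⟨rfl, hk⟩ y y' hy hy'
    obtain ⟨a, b, ha, hb, hd, e⟩ := D.exists_pair_eq_mul_core hk y'.1 y'.2
    exact ⟨y, (a, b), hy, ⟨ha, hb, fun h => hy'.1.not_dvd D.P_pos hy'.2.1 (hd h)⟩, by simp, e⟩
  · rintro x x' hx hx'
    obtain ⟨k, hk, a, b, ha, hb, hd, e⟩ := D.exists_mul_core_eq_pair x'.1 x'.2
    exact ⟨(1, k), ⟨rfl, hk⟩, x, (a, b), hx, ⟨ha, fun h => hx'.2.2 (hd h), hb⟩, by simp, e⟩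

theorem existsUnique_central_form {g : Γ} (hg : g ∈ Subgroup.closure {A, B}) :
    ∃! w, IsForm (fun x => IsRepA (2 * P) x.1 ∧ IsRepA q x.2)
      (fun x => IsRepA (2 * P) x.1 ∧ IsRepB Q x.2 ∧ x.2 ≠ 0) (IsMid P Q)
      (fun x => IsRepA P x.1 ∧ x.1 ≠ 0 ∧ IsRepA q x.2) w ∧ evalWord A B w = g := by
  refine D.existsUnique_isForm {k | ∃ m n : ℤ, k = (A ^ (P * m), B ^ (Q * n))} (fun x h => h)
    (fun x h => ⟨h.1, D.isRepA_of_isRepB h.2.1⟩) (fun x h => ⟨D.isRepA_two_mul h.1, h.2.2⟩)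
    ?_ ?_ ?_ ?_ ?_ ?_
  · obtain ⟨w, hw, m, n, rfl⟩ := D.exists_central_normal hg
    exact ⟨w, hw, _, ⟨m, n, rfl⟩, rfl⟩
  · rintro w w' hw hw' _ ⟨m, n, rfl⟩ _ ⟨m', n', rfl⟩ h
    obtain ⟨rfl, hA, hB⟩ := D.central_normal_unique hw hw' h
    exact ⟨rfl, Prod.ext hA hB⟩
  · rintro _ ⟨m, n, rfl⟩ y -
    obtain ⟨a, ha, ea, -⟩ := D.exists_zpow_A_eq (P * m + y.1)
    obtain ⟨b, hb, eb, -⟩ := D.exists_zpow_B_eq (y.2 + Q * n)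
    exact ⟨(a, b), ⟨ha, hb⟩, by rw [ea, eb, zpow_add, zpow_add]; simp only [mul_assoc]⟩
  · rintro ⟨a, b⟩ -
    obtain ⟨a', m, ha, rfl⟩ := exists_isRepA D.P_pos a
    obtain ⟨b', n, hb, rfl⟩ := exists_isRepB D.Q_pos D.Q_odd b
    refine ⟨_, ⟨m, n, rfl⟩, (a', b'), ⟨ha, hb⟩, ?_⟩
    rw [add_comm a', zpow_add, zpow_add]
    simp only [mul_assoc]
  · rintro _ ⟨m, n, rfl⟩ y y' hy hy'
    obtain ⟨a, ha, ea, -⟩ := D.exists_zpow_A_eq (P * m + y.1)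
    obtain ⟨b, hb, eb, -⟩ := D.exists_zpow_B_eq (y'.2 + Q * n)
    refine ⟨(a, y.2), (y'.1, b), ⟨ha, hy.2⟩, ⟨hy'.1, hy'.2.1, hb⟩, ?_, ?_⟩
    · rw [ea, zpow_add, mul_assoc]
    · rw [eb, zpow_add, mul_assoc]
  · rintro ⟨a, b⟩ ⟨a', b'⟩ hx hx'
    obtain ⟨a₁, m, ha, rfl⟩ := exists_isRepA D.P_pos a
    obtain ⟨b₁, n, hb, rfl⟩ := exists_isRepB D.Q_pos D.Q_odd b'
    refine ⟨_, ⟨m, n, rfl⟩, (a₁, b), (a', b₁), ⟨ha, hx.2⟩, ⟨hx'.1, hx'.2.1, hb⟩, ?_, ?_⟩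
    · rw [add_comm a₁, zpow_add, mul_assoc]
    · rw [zpow_add, mul_assoc]

end PingPong

/-! ### Translating the canonical forms. -/

theorem inHalf_iff {m : ℕ} {a : ℤ} : InHalf m a ↔ IsRepA m a := by
  unfold InHalf IsRepA
  rw [Set.mem_Ioc]
  refine and_congr ?_ ?_
  · rw [neg_lt, ← sub_pos, ← sub_pos (b := (-(m : ℤ))), ← Int.cast_pos (R := ℚ)]
    push_cast
    constructor <;> intro h <;> linarith
  · rw [← Int.cast_le (R := ℚ)]
    push_cast
    constructor <;> intro h <;> linarith

theorem inQuarter_iff {P : ℕ} {a : ℤ} : InQuarter (2 * P) a ↔ IsRepA P a := by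
  rw [← inHalf_iff, InQuarter, InHalf]
  push_cast
  rw [show (2 * (P : ℚ)) / 4 = P / 2 by ring]

theorem mem_Ioo_half_iff {m : ℕ} {b : ℤ} :
    (b : ℚ) ∈ Set.Ioo (-((m : ℚ) / 2)) ((m : ℚ) / 2) ↔ IsRepB m b := by
  unfold IsRepB
  rw [Set.mem_Ioo]
  refine and_congr ?_ ?_
  · rw [← Int.cast_lt (R := ℚ)]
    push_cast
    constructor <;> intro h <;> linarith
  · rw [← Int.cast_lt (R := ℚ)]
    push_cast
    constructor <;> intro h <;> linarith

theorem inSmall_iff {Q q : ℕ} (hQ : Odd Q) (hq : q = Q ∨ q = 2 * Q) {b : ℤ} :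
    InSmall q b ↔ IsRepB Q b := by
  rw [← mem_Ioo_half_iff, InSmall]
  rcases hq with rfl | rfl
  · have := Nat.not_even_iff_odd.mpr hQ
    simp [hQ, this]
  · have h : Even (2 * Q) := even_two_mul Q
    have h' := Nat.not_odd_iff_even.mpr h
    have e : ((2 * Q : ℕ) : ℚ) / 4 = Q / 2 := by push_cast; ring
    simp only [h, h', e, false_imp_iff, true_imp_iff, true_and]

theorem eq_half_iff {m : ℕ} {a : ℤ} : (a : ℚ) = (m : ℚ) / 2 ↔ 2 * a = m := by
  rw [eq_div_iff two_ne_zero, mul_comm]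
  exact_mod_cast Iff.rfl

/-- The only multiples of P in (-P, P] are 0 and P. This accounts for the endpoint being allowed
only when n = 1. -/
theorem not_dvd_iff_of_isRepA {P : ℕ} (hP : 0 < P) {a : ℤ} (ha : IsRepA (2 * P) a) :
    ¬ (P : ℤ) ∣ a ↔ a ≠ 0 ∧ 2 * a ≠ (2 * P : ℕ) := by
  obtain ⟨h1, h2⟩ := ha
  rw [← not_or, not_iff_not]
  push_cast
  constructor
  · rintro ⟨c, rfl⟩
    have hc1 : -1 < c := by nlinarith
    have hc2 : c ≤ 1 := by nlinarith
    interval_cases c <;> simp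
  · rintro (rfl | h)
    · exact dvd_zero _
    · exact ⟨1, by omega⟩

theorem not_dvd_iff_of_isRepA_or {Q q : ℕ} (hQ : Odd Q) (hq : q = Q ∨ q = 2 * Q) {b : ℤ}
    (hb : IsRepA q b) : ¬ (Q : ℤ) ∣ b ↔ b ≠ 0 ∧ 2 * b ≠ q := by
  rcases hq with rfl | rfl
  · have h2 : 2 * b ≠ q := by
      obtain ⟨k, rfl⟩ := hQ
      push_cast
      omega
    refine ⟨fun h => ⟨?_, h2⟩, fun h => hb.not_dvd (by exact_mod_cast hQ.pos) h.1⟩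
    rintro rfl
    exact h (dvd_zero _)
  · exact not_dvd_iff_of_isRepA hQ.pos (by exact_mod_cast hb)

theorem isLCanonical_iff {P Q q : ℕ} (hQ : Odd Q) (hq : q = Q ∨ q = 2 * Q)
    {w : List (ℤ × ℤ)} : IsLCanonical (2 * P) q w ↔
    IsForm (fun x => IsRepA (2 * P) x.1 ∧ IsRepA q x.2)
      (fun x => IsRepA (2 * P) x.1 ∧ IsRepA q x.2 ∧ ¬ (Q : ℤ) ∣ x.2) (IsMid P Q)
      (fun x => IsRepA P x.1 ∧ x.1 ≠ 0 ∧ IsRepB Q x.2) w := by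
  rw [isForm_iff, IsLCanonical, IsReduced, and_assoc]
  refine and_congr_right fun h0 => ?_
  rw [← forall_and]
  refine forall_congr' fun i => ?_
  rw [← forall_and]
  refine forall_congr' fun hi => ?_
  unfold IsMid
  generalize w[i] = x
  generalize w.length = n at *
  have hA := inHalf_iff (m := 2 * P) (a := x.1)
  push_cast at hA
  have hd := not_dvd_iff_of_isRepA_or hQ hq (b := x.2)
  rw [hA, inHalf_iff, inQuarter_iff, inSmall_iff hQ hq, eq_half_iff]
  grind

theorem isRCanonical_iff {P Q q : ℕ} (hP : 0 < P) (hQ : Odd Q) (hq : q = Q ∨ q = 2 * Q)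
    {w : List (ℤ × ℤ)} : IsRCanonical (2 * P) q w ↔
    IsForm (fun x => IsRepA (2 * P) x.1 ∧ IsRepA q x.2)
      (fun x => IsRepA P x.1 ∧ IsRepB Q x.2 ∧ x.2 ≠ 0) (IsMid P Q)
      (fun x => IsRepA (2 * P) x.1 ∧ IsRepA q x.2 ∧ ¬ (P : ℤ) ∣ x.1) w := by
  rw [isForm_iff, IsRCanonical, IsReduced, and_assoc]
  refine and_congr_right fun h0 => ?_
  rw [← forall_and]
  refine forall_congr' fun i => ?_
  rw [← forall_and]
  refine forall_congr' fun hi => ?_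
  unfold IsMid
  generalize w[i] = x
  generalize w.length = n at *
  have hA := inHalf_iff (m := 2 * P) (a := x.1)
  push_cast at hA
  have hd := not_dvd_iff_of_isRepA hP (a := x.1)
  rw [hA, inHalf_iff, inQuarter_iff, inSmall_iff hQ hq, eq_half_iff]
  grind

theorem isCCanonical_iff {P Q q : ℕ} (hQ : Odd Q) (hq : q = Q ∨ q = 2 * Q)
    {w : List (ℤ × ℤ)} : IsCCanonical (2 * P) q w ↔
    IsForm (fun x => IsRepA (2 * P) x.1 ∧ IsRepA q x.2)
      (fun x => IsRepA (2 * P) x.1 ∧ IsRepB Q x.2 ∧ x.2 ≠ 0) (IsMid P Q)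
      (fun x => IsRepA P x.1 ∧ x.1 ≠ 0 ∧ IsRepA q x.2) w := by
  rw [isForm_iff, IsCCanonical, IsReduced, and_assoc]
  refine and_congr_right fun h0 => ?_
  rw [← forall_and]
  refine forall_congr' fun i => ?_
  rw [← forall_and]
  refine forall_congr' fun hi => ?_
  unfold IsMid
  generalize w[i] = x
  generalize w.length = n at *
  have hA := inHalf_iff (m := 2 * P) (a := x.1)
  push_cast at hA
  rw [hA, inHalf_iff, inQuarter_iff, inSmall_iff hQ hq]
  grind

end RadinSadun

theorem theorem3 (p q : ℕ) (hp : 3 ≤ p) (hq : 3 ≤ q) (hpe : Even p) (hq4 : ¬ 4 ∣ q)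
    (g : RadinSadun.SO3) (hg : g ∈ RadinSadun.G p q) :
    (∃! w : List (ℤ × ℤ), RadinSadun.IsLCanonical p q w ∧ RadinSadun.wordProd p q w = g) ∧
    (∃! w : List (ℤ × ℤ), RadinSadun.IsRCanonical p q w ∧ RadinSadun.wordProd p q w = g) ∧
    (∃! w : List (ℤ × ℤ), RadinSadun.IsCCanonical p q w ∧ RadinSadun.wordProd p q w = g) := by
  obtain ⟨P, rfl⟩ := even_iff_two_dvd.mp hpe
  have hP : 0 < P := by omega
  -- Here 4 ∤ q enters: half of an even q is odd.
  obtain ⟨Q, hQ, hqQ⟩ : ∃ Q : ℕ, Odd Q ∧ (q = Q ∨ q = 2 * Q) := by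
    rcases Nat.even_or_odd' q with ⟨c, h | h⟩
    · refine ⟨c, Nat.not_even_iff_odd.mp fun ⟨d, hd⟩ => hq4 ⟨d, by omega⟩, .inr h⟩
    · exact ⟨q, ⟨c, h⟩, .inl rfl⟩
  obtain ⟨D⟩ := RadinSadun.nonempty_pingPong hP hQ hqQ
  simp only [RadinSadun.isLCanonical_iff hQ hqQ, RadinSadun.isRCanonical_iff hP hQ hqQ,
    RadinSadun.isCCanonical_iff hQ hqQ]
  exact ⟨D.existsUnique_left_form hg, D.existsUnique_right_form hg,
    D.existsUnique_central_form hg⟩
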